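/- **The network.** Consider the broken-diamond network with nodes $1,\dots,6$: its interference graph is the complete tripartite graph with parts $\{1,2\},\{3,4\},\{5,6\}$ from which the edge between nodes $4$ and $5$ is removed. Let $\gamma\in(1,\infty)$ and let $\lambda=(\lambda_1,\dots,\lambda_6)$ be positive arrival rates. The Markov process $(U(t),X(t))$ describes the activity indicators and the queue lengths: the active nodes form an independent set of the interference graph, and active nodes have nonempty queues. Packets arrive at node $i$ at rate $\lambda_i$; a node with a nonempty queue that is inactive and has no active neighbour activates at rate $1$; an active node completes transmissions at rate $1$, and after a completion that leaves $x$ packets in its queue it releases the medium with probability $(1+x)^{-\gamma}$ and otherwise stays active. **Fluid limits.** Let $(U(n),X(n))_{n\ge0}$ be the jump chain of this process uniformized at rate $\beta=\sum_{i}\lambda_i+6$, let $I(n)=\sum_{k=0}^n U(k)$, and let $(\overline Q(t),\overline I(t))_{t\ge0}$ be the continuous process that is linear between the times $n/\beta$ and takes the value $(X(n),I(n))$ at $n/\beta$. For $R\in\mathbb N$, start the chain in a deterministic state $(U^{(R)}(0),X^{(R)}(0))$, put $(Q^R(t),I^R(t))=\frac1R\bigl(\overline Q(Rt),\overline I(Rt)\bigr)$,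 and let $\mu_R$ be its law on the space of continuous paths on $[0,\infty)$ with the topology of locally uniform convergence. Given $q$, a *fluid limit measure* with initial condition $Q(0)=q$ is a weak limit $\mu$ of a subsequence of $(\mu_R)$, for initial states with $X^{(R)}(0)/R\to q$. The coordinate process under $\mu$ is denoted $(Q,I)$. A state $(Q_1,\dots,Q_6)$ is *natural* if $Q_3\ge Q_4$ and $Q_6\ge Q_5$, in each case with equality only when both sides are zero. Write $\rho=\max(\lambda_1,\lambda_2)+\lambda_3+\lambda_6$ for the load. **Theorem.** Assume $\lambda_1=\lambda_2>0$, $\lambda_4=\lambda_5>0$, $\lambda_3>\lambda_4$ and $\lambda_6>\lambda_5$. Then there is a deterministic time $T_N>0$, depending only on $\gamma$ and $\lambda$, such that for every $q$ with $\|q\|=1$ (Euclidean norm) and every fluid limit measure $\mu$ with $Q(0)=q$, $\mu$-almost surely the state $Q(t)$ is natural for all $t\ge T_N$; in particular $Q_3(t)\ge Q_4(t)$ and $Q_6(t)\ge Q_5(t)$ for all $t\ge T_N$. Moreover, the times $T_N=T_N(\gamma,\lambda)$ can be chosen such that the following holds as well. Let $\lambda=\rho\kappa$ with a fixed vector $\kappa$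 that satisfies the same conditions as $\lambda$ above and has $\max(\kappa_1,\kappa_2)+\kappa_3+\kappa_6=1$. Then for every $q$ with $\|q\|=1$ there is $\rho^*<1$ such that for all $\rho\in[\rho^*,1)$ and every fluid limit measure $\mu$ for the arrival rates $\rho\kappa$ with $Q(0)=q$, $\mu$-almost surely $\max_\ell Q_\ell(T_N)>0$, i.e. the network is nonempty at time $T_N=T_N(\gamma,\rho\kappa)$. -/

import Mathlib

open MeasureTheory Filter Topology
open scoped NNReal ENNReal

noncomputable section

namespace BrokenDiamond

/-! ### The network

The six nodes `1, …, 6` are the elements `0, …, 5` of `Fin 6`. -/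

/-- The component of a node: `{1, 2}`, `{3, 4}` and `{5, 6}` are the components `0`, `1`, `2`. -/
def component (i : Fin 6) : ℕ := (i : ℕ) / 2

/-- The interference graph of the broken-diamond network: the complete tripartite graph on the
components `{1, 2}`, `{3, 4}`, `{5, 6}`, without the edge between the nodes `4` and `5`. -/
def graph : SimpleGraph (Fin 6) where
  Adj i j := component i ≠ component j ∧ ¬ (i = 3 ∧ j = 4) ∧ ¬ (i = 4 ∧ j = 3)
  symm := ⟨fun _ _ h => ⟨h.1.symm, fun h' => h.2.2 ⟨h'.2, h'.1⟩, fun h' => h.2.1 ⟨h'.2, h'.1⟩⟩⟩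
  loopless := ⟨fun _ h => h.1 rfl⟩

/-- A state `(U, X)`: the activity indicators and the queue lengths (including the packets
that are being transmitted). -/
abbrev State := (Fin 6 → Bool) × (Fin 6 → ℕ)

/-- The states of the Markov process: the active nodes form an independent set of the
interference graph, and an active node has a packet to transmit. -/
def State.Feasible (s : State) : Prop :=
  (∀ i j, graph.Adj i j → ¬ (s.1 i = true ∧ s.1 j = true)) ∧
    ∀ i, s.1 i = true → 1 ≤ s.2 i

/-- A node may activate if it has a packet, is not active, and has no active neighbour. -/
def State.CanActivate (s : State) (i : Fin 6) : Prop :=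
  1 ≤ s.2 i ∧ s.1 i = false ∧ ∀ j, graph.Adj i j → s.1 j = false

/-- The probability `1 / (1 + x) ^ γ` that a node which completes a transmission and leaves `x`
packets behind releases the medium (it is `1` when the queue has become empty). -/
def backoffProb (γ : ℝ) (x : ℕ) : ℝ := 1 / (1 + (x : ℝ)) ^ γ

/-! ### The uniformized jump chain -/

/-- The data of one tick of the uniformization clock: an arrival at node `i` (`Sum.inl i`) or a
tick of the unit-rate service and back-off clock of node `i` (`Sum.inr i`), and an independent
uniform variable for the decision whether to release the medium. -/
abbrev Tick := (Fin 6 ⊕ Fin 6) × unitInterval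

open scoped Classical in
/-- The transition of the jump chain at a clock tick.
* Arrival at `i`: the queue of `i` grows by one.
* Clock of an active node `i`: one transmission is completed, and the node releases the medium with
  probability `backoffProb γ` of the remaining queue length, or keeps it otherwise.
* Clock of an inactive node `i`: it becomes active if it can (it has a packet and is unblocked);
  otherwise nothing happens. -/
def step (γ : ℝ) (s : State) : Tick → State
  | (Sum.inl i, _) => (s.1, Function.update s.2 i (s.2 i + 1))
  | (Sum.inr i, v) =>
    if s.1 i = true then
      (if (v : ℝ) ≤ backoffProb γ (s.2 i - 1) then Function.update s.1 i false else s.1,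
        Function.update s.2 i (s.2 i - 1))
    else if s.CanActivate i then (Function.update s.1 i true, s.2)
    else s

/-- The jump chain started from `s`, driven by a sequence of ticks. -/
def chain (γ : ℝ) (s : State) (e : ℕ → Tick) : ℕ → State
  | 0 => s
  | n + 1 => step γ (chain γ s e n) (e n)

/-- The uniformization rate `β = ∑ λ_ℓ + 6`. -/
def clockRate (lam : Fin 6 → ℝ≥0) : ℝ≥0 := ∑ i, lam i + 6

/-- The law of the type of a tick: an arrival at `i` has probability `λ_i / β`, a tick of the
unit-rate clock of `i` has probability `1 / β`. -/
def tickTypeLaw (lam : Fin 6 → ℝ≥0) : Measure (Fin 6 ⊕ Fin 6) :=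
  ∑ i, ((lam i / clockRate lam : ℝ≥0) : ℝ≥0∞) • Measure.dirac (Sum.inl i) +
    ∑ i : Fin 6, ((1 / clockRate lam : ℝ≥0) : ℝ≥0∞) • Measure.dirac (Sum.inr i)

instance (lam : Fin 6 → ℝ≥0) : IsProbabilityMeasure (tickTypeLaw lam) := by
  constructor
  have hpos : clockRate lam ≠ 0 := by
    unfold clockRate; positivity
  simp only [tickTypeLaw, Measure.coe_add, Measure.coe_finsetSum, Pi.add_apply,
    Finset.sum_apply, Measure.smul_apply, measure_univ, smul_eq_mul, mul_one]
  rw [← ENNReal.ofNNReal_finsetSum, ← ENNReal.ofNNReal_finsetSum, ← ENNReal.coe_add, ← Finset.sum_div]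
  rw [ENNReal.coe_eq_one, Finset.sum_const, Finset.card_univ, Fintype.card_fin, nsmul_eq_mul,
    mul_one_div, ← add_div]
  exact div_self hpos

/-- The law of one tick. -/
def tickLaw (lam : Fin 6 → ℝ≥0) : Measure Tick := (tickTypeLaw lam).prod volume

instance (lam : Fin 6 → ℝ≥0) : IsProbabilityMeasure (tickLaw lam) := by
  unfold tickLaw; infer_instance

/-- The law of an independent and identically distributed sequence of ticks. -/
def ticksLaw (lam : Fin 6 → ℝ≥0) : ProbabilityMeasure (ℕ → Tick) :=
  ⟨Measure.infinitePi fun _ => tickLaw lam, inferInstance⟩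

/-! ### Interpolation and fluid scaling -/

/-- Pairs of a vector of queue lengths and a vector of cumulative activities. -/
abbrev Phase := (Fin 6 → ℝ) × (Fin 6 → ℝ)

/-- Continuous paths on `[0, ∞)`, with the topology of uniform convergence on compact sets and
its Borel `σ`-algebra. -/
abbrev Path := C(ℝ≥0, Phase)

instance : MeasurableSpace Path := borel Path

instance : BorelSpace Path := ⟨rfl⟩

/-- The queue-length component of a path. -/
def Path.Q (ω : Path) (t : ℝ≥0) (i : Fin 6) : ℝ := (ω t).1 i

/-- The pair `(X(n), I(n))` of queue lengths and cumulative activities `I(n) = ∑_{k ≤ n} U(k)`. -/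
def record (s : ℕ → State) (n : ℕ) : Phase :=
  (fun i => ((s n).2 i : ℝ),
    fun i => ∑ k ∈ Finset.range (n + 1), if (s k).1 i = true then (1 : ℝ) else 0)

/-- Linear interpolation of a sequence: the value at `x ∈ [n, n + 1]` is
`(n + 1 - x) a(n) + (x - n) a(n + 1)`. -/
def interp (a : ℕ → Phase) (x : ℝ≥0) : Phase :=
  ((⌊x⌋₊ : ℝ) + 1 - x) • a ⌊x⌋₊ + ((x : ℝ) - ⌊x⌋₊) • a (⌊x⌋₊ + 1)

/-- The sequence of clock ticks is run at rate `β`, and time and space are scaled by `R`. -/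
def scaledValue (β : ℝ≥0) (R : ℕ) (s : ℕ → State) (t : ℝ≥0) : Phase :=
  (1 / (R : ℝ)) • interp (record s) (β * (R * t))

lemma interp_eq_sum (a : ℕ → Phase) (K : ℕ) (x : ℝ≥0) (hx : x < K) :
    interp a x = a 0 + ∑ j ∈ Finset.range K,
      (max 0 (min 1 ((x : ℝ) - j))) • (a (j + 1) - a j) := by
  have hk : ⌊x⌋₊ < K := (Nat.floor_lt zero_le).2 hx
  have h1 : (⌊x⌋₊ : ℝ) ≤ x := by exact_mod_cast Nat.floor_le (zero_le (a := x))
  have h2 : (x : ℝ) < ⌊x⌋₊ + 1 := by exact_mod_cast Nat.lt_floor_add_one x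
  unfold interp
  generalize ⌊x⌋₊ = k at *
  obtain ⟨d, rfl⟩ : ∃ d, K = k + 1 + d := ⟨K - (k + 1), by omega⟩
  rw [Finset.sum_range_add, Finset.sum_range_succ]
  have e1 : ∑ j ∈ Finset.range k, (max 0 (min 1 ((x : ℝ) - j))) • (a (j + 1) - a j)
      = a k - a 0 := by
    rw [← Finset.sum_range_sub]
    refine Finset.sum_congr rfl fun j hj => ?_
    have hj' : ((j + 1 : ℕ) : ℝ) ≤ k := by exact_mod_cast Finset.mem_range.1 hj
    push_cast at hj'
    rw [min_eq_left (by linarith), max_eq_right (by norm_num), one_smul]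
  have e2 : ∑ j ∈ Finset.range d,
      (max 0 (min 1 ((x : ℝ) - ((k + 1 + j : ℕ) : ℝ)))) •
        (a (k + 1 + j + 1) - a (k + 1 + j)) = 0 := by
    refine Finset.sum_eq_zero fun j _ => ?_
    have : (0 : ℝ) ≤ j := Nat.cast_nonneg j
    push_cast
    rw [max_eq_left (min_le_of_right_le (by linarith)), zero_smul]
  rw [e1, e2, min_eq_right (by linarith), max_eq_right (by linarith)]
  module

lemma continuous_interp : Continuous fun p : (ℕ → Phase) × ℝ≥0 => interp p.1 p.2 := by
  rw [continuous_iff_continuousAt]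
  intro p
  obtain ⟨K, hK⟩ := exists_nat_gt p.2
  have hopen : {p' : (ℕ → Phase) × ℝ≥0 | p'.2 < K} ∈ 𝓝 p :=
    (isOpen_lt continuous_snd continuous_const).mem_nhds hK
  have hcont : Continuous fun p : (ℕ → Phase) × ℝ≥0 => p.1 0 + ∑ j ∈ Finset.range K,
      (max 0 (min 1 ((p.2 : ℝ) - j))) • (p.1 (j + 1) - p.1 j) := by
    fun_prop
  exact hcont.continuousAt.congr
    (by filter_upwards [hopen] with p' hp' using (interp_eq_sum p'.1 K p'.2 hp').symm)

lemma continuous_record : Continuous record := by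
  refine continuous_pi fun n => Continuous.prodMk ?_ ?_
  · refine continuous_pi fun i => ?_
    exact (continuous_of_discreteTopology (f := fun m : ℕ => (m : ℝ))).comp (by fun_prop)
  · refine continuous_pi fun i => continuous_finsetSum _ fun k _ => ?_
    exact (continuous_of_discreteTopology (f := fun b : Bool => if b = true then (1 : ℝ) else 0)).comp
      (by fun_prop)

lemma continuous_scaledValue (β : ℝ≥0) (R : ℕ) :
    Continuous fun p : (ℕ → State) × ℝ≥0 => scaledValue β R p.1 p.2 := by
  have h : Continuous fun p : (ℕ → State) × ℝ≥0 => (record p.1, β * (R * p.2)) :=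
    (continuous_record.comp continuous_fst).prodMk (by fun_prop)
  have h' := continuous_interp.comp h
  simp only [Function.comp_def] at h'
  simp only [scaledValue]
  exact h'.const_smul (1 / (R : ℝ))

/-- The fluid-scaled path `t ↦ (Q^R(t), I^R(t))` of a sequence of states. -/
def scaledPath (β : ℝ≥0) (R : ℕ) (s : ℕ → State) : Path where
  toFun := scaledValue β R s
  continuous_toFun := by
    have h := (continuous_scaledValue β R).comp (Continuous.prodMk_right s)
    simpa only [Function.comp_def] using h

lemma continuous_scaledPath (β : ℝ≥0) (R : ℕ) : Continuous (scaledPath β R) :=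
  ContinuousMap.continuous_of_continuous_uncurry _ (continuous_scaledValue β R)

instance : BorelSpace State :=
  haveI : BorelSpace Bool := ⟨borel_eq_top_of_discrete.symm⟩
  inferInstance

instance : MeasurableSingletonClass (Fin 6 ⊕ Fin 6) :=
  ⟨fun _ => measurableSet_sum_iff.2 ⟨Set.Finite.measurableSet (Set.toFinite _),
    Set.Finite.measurableSet (Set.toFinite _)⟩⟩

lemma measurable_step (γ : ℝ) : Measurable fun p : State × Tick => step γ p.1 p.2 := by
  refine measurable_from_prod_countable_right fun s => ?_
  refine measurable_from_prod_countable_right fun k => ?_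
  rcases k with i | i
  · simp only [step]
    exact measurable_const
  · simp only [step]
    split_ifs
    · exact (Measurable.ite (measurableSet_le measurable_subtype_coe measurable_const)
        measurable_const measurable_const).prodMk measurable_const
    · exact measurable_const
    · exact measurable_const

lemma measurable_chain (γ : ℝ) (s : State) : Measurable (chain γ s) := by
  refine measurable_pi_lambda _ fun n => ?_
  induction n with
  | zero => exact measurable_const
  | succ n ih => exact (measurable_step γ).comp (ih.prodMk (measurable_pi_apply n))

/-- The law `μ_R` on path space of the fluid-scaled interpolated jump chain with arrival rates
`lam` and back-off exponent `γ`, started from the state `s`. -/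
def scaledLaw (γ : ℝ) (lam : Fin 6 → ℝ≥0) (R : ℕ) (s : State) : ProbabilityMeasure Path :=
  (ticksLaw lam).map (f := fun e => scaledPath (clockRate lam) R (chain γ s e))
    ((continuous_scaledPath _ R).measurable.comp (measurable_chain γ s)).aemeasurable

/-- `μ` is a fluid limit measure with initial condition `q`: it is the weak limit, along a
subsequence, of the laws `μ_R` for initial states whose scaled queue lengths converge to `q`. -/
def IsFluidLimit (γ : ℝ) (lam : Fin 6 → ℝ≥0) (q : EuclideanSpace ℝ (Fin 6))
    (μ : ProbabilityMeasure Path) : Prop :=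
  ∃ init : ℕ → State, (∀ R, (init R).Feasible) ∧
    Tendsto (fun R : ℕ => WithLp.toLp 2 fun i => ((init R).2 i : ℝ) / R) atTop (𝓝 q) ∧
    ∃ φ : ℕ → ℕ, StrictMono φ ∧
      Tendsto (fun n => scaledLaw γ lam (φ n) (init (φ n))) atTop (𝓝 μ)

/-! ### Natural states and the conditions on the arrival rates -/

/-- Natural states: `q₃ ≥ q₄` and `q₆ ≥ q₅`, with equality only when both sides are zero. -/
def IsNatural (q : Fin 6 → ℝ) : Prop :=
  (q 3 ≤ q 2 ∧ (q 2 = q 3 → q 2 = 0 ∧ q 3 = 0)) ∧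
    (q 4 ≤ q 5 ∧ (q 5 = q 4 → q 5 = 0 ∧ q 4 = 0))

/-- The conditions on the arrival rates: they are positive, and
`λ₁ = λ₂`, `λ₄ = λ₅`, `λ₃ > λ₄`, `λ₆ > λ₅`. -/
def RateCondition (lam : Fin 6 → ℝ≥0) : Prop :=
  (∀ i, 0 < lam i) ∧ lam 0 = lam 1 ∧ lam 3 = lam 4 ∧ lam 3 < lam 2 ∧ lam 4 < lam 5

/-- The load `ρ = max (λ₁, λ₂) + λ₃ + λ₆`. -/
def load (lam : Fin 6 → ℝ≥0) : ℝ≥0 := max (lam 0) (lam 1) + lam 2 + lam 5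

end BrokenDiamond

end

/-!
The comments number the nodes `1, …, 6`; they are the elements `0, …, 5` of `Fin 6`.

The proof compares queues of the jump chain directly and passes to the fluid limit by the
portmanteau theorem; the fluid limits need not be described any further.

*Natural states.* Every neighbour of node `4` is a neighbour of node `3`. Hence, while node `3` is
active, node `4` activates as soon as it has a packet, and a node with a long queue hardly ever
releases the medium. While the queue of node `4` is long, node `3` is therefore active for at most
as long as node `4`, up to a negligible time, and `Q₃ - Q₄` grows at a rate of at least
`(λ₃ - λ₄) / 2` (`drift_le`, `ae_growth`). Either `Q₄` vanishes, and then `Q₃ ≥ Q₄` is trivial, or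
`Q₃ - Q₄` has been growing since the last zero of `Q₄` or since the beginning (`le_of_growth`). As
`Q₃(0) - Q₄(0) ≥ -1`, the state is natural after time `2 / (λ₃ - λ₄)`. The nodes `6` and `5` are
treated in the same way.

*Nonemptiness.* The nodes `1, 3, 6` form a clique, so that at most one of them is active at a time
and their workload decreases at most at rate `1 - ρ` (`ae_workload`); the same holds for `2, 3, 6`.
If one of these cliques has work initially, then it still has work at the settling time when `ρ` is
close to `1`. Otherwise node `4` or node `5` has work, say node `4`. Since `γ > 1`, it does not
release the medium during a short initial period on the fluid scale. Either it does not activate in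
the first half of this period, and then node `3` is not served and its queue grows, or it holds the
medium during the second half, and the queue of its neighbour `1` grows (`ae_feed`). In both cases
the clique `1, 3, 6` receives an amount of work that is bounded away from zero as `ρ → 1`, to which
the first case applies.

All laws of large numbers come from one Chernoff bound for bounded increments with nonnegative
drift (`prob_sum_le`). It rests on the independence of the ticks, used through the fact that
resampling one tick preserves the law of the sequence (`map_update_infinitePi`).
-/

namespace BrokenDiamond

/-! ### The chain and its driving sequence -/

lemma State.Feasible.step {γ : ℝ} {s : State} (hs : s.Feasible) (x : Tick) :
    (step γ s x).Feasible := by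
  obtain ⟨i | i, v⟩ := x
  · refine ⟨hs.1, fun j hj => ?_⟩
    have := hs.2 j hj
    rcases eq_or_ne j i with rfl | h
    · simp [BrokenDiamond.step]
    · simpa [BrokenDiamond.step, h] using this
  · simp only [BrokenDiamond.step]
    split_ifs with h1 h2 h3
    · refine ⟨fun j k hjk hc => ?_, fun j hj => ?_⟩
      · rcases eq_or_ne j i with rfl | hj
        · simp at hc
        rcases eq_or_ne k i with rfl | hk
        · simp at hc
        exact hs.1 j k hjk (by simpa [hj, hk] using hc)
      · rcases eq_or_ne j i with rfl | h
        · simp at hj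
        · simpa [h] using hs.2 j (by simpa [h] using hj)
    · refine ⟨hs.1, fun j hj => ?_⟩
      rcases eq_or_ne j i with rfl | h
      · -- an empty queue releases the medium with probability one
        rcases Nat.lt_or_ge 1 (s.2 j) with h' | h'
        · simp only [Function.update_self]; omega
        · have h0 : s.2 j - 1 = 0 := by omega
          exact absurd (by simpa [backoffProb, h0] using v.2.2) h2
      · simpa [h] using hs.2 j hj
    · refine ⟨fun j k hjk hc => ?_, fun j hj => ?_⟩
      · rcases eq_or_ne j i with rfl | hj
        · have hk : k ≠ j := hjk.ne'
          have := h3.2.2 k hjk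
          simp [hk, this] at hc
        rcases eq_or_ne k i with rfl | hk
        · have := h3.2.2 j hjk.symm
          simp [hj, this] at hc
        exact hs.1 j k hjk (by simpa [hj, hk] using hc)
      · rcases eq_or_ne j i with rfl | h
        · exact h3.1
        · exact hs.2 j (by simpa [h] using hj)
    · exact hs

lemma State.Feasible.chain {γ : ℝ} {s : State} (hs : s.Feasible) (e : ℕ → Tick) (n : ℕ) :
    (chain γ s e n).Feasible := by
  induction n with
  | zero => exact hs
  | succ n ih => exact ih.step _

/-- The state at time `n` depends on the ticks before time `n` only. -/
lemma chain_update (γ : ℝ) (s : State) (e : ℕ → Tick) (x : Tick) {n k : ℕ} (hk : k ≤ n) :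
    chain γ s (Function.update e n x) k = chain γ s e k := by
  induction k with
  | zero => rfl
  | succ k ih =>
    rw [chain, chain, ih (by omega), Function.update_of_ne (by omega)]

lemma measurable_chain_apply (γ : ℝ) (s : State) (n : ℕ) :
    Measurable fun e => chain γ s e n :=
  (measurable_pi_apply n).comp (measurable_chain γ s)

lemma measurable_update_prod {α : Type*} [MeasurableSpace α] (n : ℕ) :
    Measurable fun p : (ℕ → α) × α => Function.update p.1 n p.2 := by
  refine measurable_pi_lambda _ fun k => ?_
  rcases eq_or_ne k n with rfl | h
  · simpa using measurable_snd
  · simp only [Function.update_of_ne h]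
    fun_prop

/-- Resampling one coordinate of an independent sequence does not change its law. -/
lemma map_update_infinitePi {α : Type*} [MeasurableSpace α] (ν : Measure α)
    [IsProbabilityMeasure ν] (n : ℕ) :
    ((Measure.infinitePi fun _ : ℕ => ν).prod ν).map (fun p => Function.update p.1 n p.2) =
      Measure.infinitePi fun _ : ℕ => ν := by
  have hmeas : Measurable fun p : (ℕ → α) × α => Function.update p.1 n p.2 :=
    measurable_update_prod n
  refine Measure.eq_infinitePi _ fun s t ht => ?_
  rw [Measure.map_apply hmeas (MeasurableSet.pi s.countable_toSet fun i _ => ht i)]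
  have hset : (fun p : (ℕ → α) × α => Function.update p.1 n p.2) ⁻¹' (Set.pi s t) =
      (Set.pi (s.erase n : Finset ℕ) t) ×ˢ (if n ∈ s then t n else Set.univ) := by
    ext p
    simp only [Set.mem_preimage, Set.mem_pi, Set.mem_prod, Finset.mem_coe, Finset.mem_erase]
    constructor
    · refine fun h => ⟨fun i hi => by simpa [hi.1] using h i hi.2, ?_⟩
      split_ifs with hn
      · simpa using h n hn
      · trivial
    · rintro ⟨h1, h2⟩ i hi
      rcases eq_or_ne i n with rfl | hin
      · simpa [hi] using h2
      · simpa [hin] using h1 i ⟨hin, hi⟩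
  rw [hset, Measure.prod_prod, Measure.infinitePi_pi _ fun i _ => ht i]
  split_ifs with hn
  · rw [Finset.prod_erase_mul s (fun i => ν (t i)) hn]
  · rw [measure_univ, mul_one, Finset.erase_eq_of_notMem hn]

/-- The Markov property, in the form of a bound on multiplicative functionals of the chain. -/
lemma lintegral_prod_chain_le (γ : ℝ) (lam : Fin 6 → ℝ≥0) {s : State} (hs : s.Feasible)
    (F : ℕ → State × Tick → ℝ≥0∞) (hF : ∀ k, Measurable (F k)) (K : ℕ → ℝ≥0∞)
    (h : ∀ k s, s.Feasible → ∫⁻ x, F k (s, x) ∂tickLaw lam ≤ K k) (n : ℕ) :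
    ∫⁻ e, ∏ k ∈ Finset.range n, F k (chain γ s e k, e k) ∂(ticksLaw lam : Measure (ℕ → Tick)) ≤
      ∏ k ∈ Finset.range n, K k := by
  have hG : ∀ k, Measurable fun e : ℕ → Tick => F k (chain γ s e k, e k) := fun k =>
    (hF k).comp ((measurable_chain_apply γ s k).prodMk (measurable_pi_apply k))
  induction n with
  | zero => simp
  | succ n ih =>
    have hP : (ticksLaw lam : Measure (ℕ → Tick)) = Measure.infinitePi fun _ => tickLaw lam := rfl
    have hmeas : Measurable fun p : (ℕ → Tick) × Tick => Function.update p.1 n p.2 :=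
      measurable_update_prod n
    have hprod : Measurable fun e : ℕ → Tick =>
        ∏ k ∈ Finset.range (n + 1), F k (chain γ s e k, e k) :=
      Finset.measurable_fun_prod _ fun k _ => hG k
    calc _ = ∫⁻ e, ∫⁻ x, (∏ k ∈ Finset.range n, F k (chain γ s e k, e k)) *
            F n (chain γ s e n, x) ∂tickLaw lam ∂(Measure.infinitePi fun _ => tickLaw lam) := by
          rw [hP]
          conv_lhs => rw [← map_update_infinitePi (tickLaw lam) n]
          rw [lintegral_map hprod hmeas]
          refine (lintegral_prod _ (hprod.comp hmeas).aemeasurable).trans ?_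
          refine lintegral_congr fun e => lintegral_congr fun x => ?_
          simp only [Function.comp]
          rw [Finset.prod_range_succ, chain_update _ _ _ _ le_rfl, Function.update_self]
          congr 1
          refine Finset.prod_congr rfl fun k hk => ?_
          have := Finset.mem_range.1 hk
          rw [chain_update _ _ _ _ this.le, Function.update_of_ne this.ne]
      _ ≤ ∫⁻ e, (∏ k ∈ Finset.range n, F k (chain γ s e k, e k)) * K n
            ∂(Measure.infinitePi fun _ => tickLaw lam) := by
          refine lintegral_mono fun e => ?_
          refine (lintegral_const_mul _ ((hF n).comp measurable_prodMk_left)).trans_le ?_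
          exact mul_le_mul_right (h n _ (hs.chain e n)) _
      _ ≤ _ := by
          rw [lintegral_mul_const _ (Finset.measurable_fun_prod _ fun k _ => hG k),
            Finset.prod_range_succ]
          exact mul_le_mul_left ih _

/-- A union bound over the first `n` steps. -/
lemma prob_exists_le (γ : ℝ) (lam : Fin 6 → ℝ≥0) {s : State} (hs : s.Feasible)
    {B : Set (State × Tick)} (hB : MeasurableSet B) {p : ℝ≥0∞}
    (h : ∀ s : State, s.Feasible → tickLaw lam {x | (s, x) ∈ B} ≤ p) (n : ℕ) :
    (ticksLaw lam : Measure (ℕ → Tick)) {e | ∃ k < n, (chain γ s e k, e k) ∈ B} ≤ n * p := by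
  have hset : {e : ℕ → Tick | ∃ k < n, (chain γ s e k, e k) ∈ B} =
      ⋃ k ∈ Finset.range n, {e | (chain γ s e k, e k) ∈ B} := by
    ext e; simp
  rw [hset]
  refine (measure_biUnion_finset_le _ _).trans ?_
  refine (Finset.sum_le_sum (g := fun _ => p) fun k _ => ?_).trans (by simp)
  have key := lintegral_prod_chain_le γ lam hs
    (fun j => if j = k then B.indicator 1 else 1)
    (fun j => by
      split_ifs
      · exact measurable_one.indicator hB
      · exact measurable_one)
    (fun j => if j = k then p else 1)
    (fun j s hs => by
      split_ifs
      · refine le_trans (le_of_eq ?_) (h s hs)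
        exact lintegral_indicator_one (measurable_prodMk_left hB)
      · simp) (k + 1)
  have h1 : ∏ j ∈ Finset.range (k + 1), (if j = k then p else 1) = p := by
    rw [Finset.prod_ite_eq']; simp
  rw [h1] at key
  refine le_trans (le_of_eq ?_) key
  refine (lintegral_indicator_one
    (((measurable_chain_apply γ s k).prodMk (measurable_pi_apply k)) hB)).symm.trans ?_
  refine lintegral_congr fun e => ?_
  rw [Finset.prod_eq_single k]
  · rw [if_pos rfl]
    rfl
  · intro j _ hj; simp [hj]
  · simp

/-- A Chernoff bound: a sum of bounded increments with nonnegative drift is unlikely to be very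
negative. -/
lemma prob_sum_le (γ : ℝ) (lam : Fin 6 → ℝ≥0) {s : State} (hs : s.Feasible)
    {Y : State × Tick → ℝ} (hY : Measurable Y) {C : ℝ} (hC : ∀ p, |Y p| ≤ C)
    (h : ∀ s : State, s.Feasible → 0 ≤ ∫ x, Y (s, x) ∂tickLaw lam)
    {θ : ℝ} (hθ : 0 ≤ θ) (hθC : θ * C ≤ 1) (a : ℝ) (m n : ℕ) :
    (ticksLaw lam : Measure (ℕ → Tick))
        {e | ∑ k ∈ Finset.Ico m n, Y (chain γ s e k, e k) ≤ -a} ≤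
      ENNReal.ofReal (Real.exp (-θ * a + n * (θ * C) ^ 2)) := by
  have hone : ∀ s : State, s.Feasible →
      ∫⁻ x, ENNReal.ofReal (Real.exp (-θ * Y (s, x))) ∂tickLaw lam ≤
        ENNReal.ofReal (Real.exp ((θ * C) ^ 2)) := by
    intro s hs
    have hYs : Measurable fun x => Y (s, x) := hY.comp measurable_prodMk_left
    have hint : Integrable (fun x => Y (s, x)) (tickLaw lam) :=
      Integrable.of_bound hYs.aestronglyMeasurable C (ae_of_all _ fun x => hC _)
    have habs : ∀ x, |-θ * Y (s, x)| ≤ θ * C := fun x => by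
      rw [abs_mul, abs_neg, abs_of_nonneg hθ]
      exact mul_le_mul_of_nonneg_left (hC _) hθ
    have hle : ∀ x, Real.exp (-θ * Y (s, x)) ≤ 1 + (θ * C) ^ 2 + -θ * Y (s, x) := by
      intro x
      have h1 := (abs_le.1 (Real.abs_exp_sub_one_sub_id_le ((habs x).trans hθC))).2
      have h2 : (-θ * Y (s, x)) ^ 2 ≤ (θ * C) ^ 2 := sq_le_sq' (abs_le.1 (habs x)).1
        (abs_le.1 (habs x)).2
      linarith
    calc _ ≤ ∫⁻ x, ENNReal.ofReal (1 + (θ * C) ^ 2 + -θ * Y (s, x)) ∂tickLaw lam :=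
          lintegral_mono fun x => ENNReal.ofReal_le_ofReal (hle x)
      _ = ENNReal.ofReal (∫ x, (1 + (θ * C) ^ 2 + -θ * Y (s, x)) ∂tickLaw lam) := by
          rw [ofReal_integral_eq_lintegral_ofReal]
          · exact (integrable_const _).add (hint.const_mul _)
          · exact ae_of_all _ fun x => (Real.exp_pos _).le.trans (hle x)
      _ ≤ _ := by
          refine ENNReal.ofReal_le_ofReal ?_
          rw [integral_add (integrable_const _) (hint.const_mul _), integral_const_mul]
          have h1 := Real.add_one_le_exp ((θ * C) ^ 2)
          have h2 := mul_nonneg hθ (h s hs)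
          simp only [integral_const, probReal_univ, smul_eq_mul, one_mul]
          linarith
  have hK : (1 : ℝ≥0∞) ≤ ENNReal.ofReal (Real.exp ((θ * C) ^ 2)) := by
    rw [ENNReal.one_le_ofReal]
    exact Real.one_le_exp (sq_nonneg _)
  have key := lintegral_prod_chain_le γ lam hs
    (fun k p => if m ≤ k then ENNReal.ofReal (Real.exp (-θ * Y p)) else 1)
    (fun k => by
      split_ifs
      · fun_prop
      · fun_prop)
    (fun _ => ENNReal.ofReal (Real.exp ((θ * C) ^ 2)))
    (fun k s hs => by
      split_ifs
      · exact hone s hs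
      · simpa using hK) n
  have hprod : ∀ e : ℕ → Tick, ∏ k ∈ Finset.range n,
      (if m ≤ k then ENNReal.ofReal (Real.exp (-θ * Y (chain γ s e k, e k))) else 1) =
      ENNReal.ofReal (Real.exp (-θ * ∑ k ∈ Finset.Ico m n, Y (chain γ s e k, e k))) := by
    intro e
    rw [← Finset.prod_filter, ← ENNReal.ofReal_prod_of_nonneg fun _ _ => (Real.exp_pos _).le,
      ← Real.exp_sum, Finset.mul_sum]
    congr 3
    ext k; simp [and_comm]
  simp only [hprod] at key
  have hsub : {e : ℕ → Tick | ∑ k ∈ Finset.Ico m n, Y (chain γ s e k, e k) ≤ -a} ⊆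
      {e | ENNReal.ofReal (Real.exp (θ * a)) ≤ ENNReal.ofReal
        (Real.exp (-θ * ∑ k ∈ Finset.Ico m n, Y (chain γ s e k, e k)))} := by
    intro e he
    refine ENNReal.ofReal_le_ofReal (Real.exp_le_exp.2 ?_)
    have := mul_le_mul_of_nonneg_left he.out hθ
    linarith
  have hmeas : Measurable fun e : ℕ → Tick => ENNReal.ofReal
        (Real.exp (-θ * ∑ k ∈ Finset.Ico m n, Y (chain γ s e k, e k))) := by
    have : ∀ k, Measurable fun e : ℕ → Tick => Y (chain γ s e k, e k) := fun k =>
      hY.comp ((measurable_chain_apply γ s k).prodMk (measurable_pi_apply k))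
    exact ((Finset.measurable_fun_sum _ fun k _ => this k).const_mul _).exp.ennreal_ofReal
  have hpos : ENNReal.ofReal (Real.exp (θ * a)) ≠ 0 := by
    simpa using Real.exp_pos _
  refine (measure_mono hsub).trans ((meas_ge_le_lintegral_div hmeas.aemeasurable hpos
    ENNReal.ofReal_ne_top).trans ?_)
  refine (ENNReal.div_le_div_right key _).trans (le_of_eq ?_)
  rw [Finset.prod_const, Finset.card_range, ← ENNReal.ofReal_pow (Real.exp_pos _).le,
    ← ENNReal.ofReal_div_of_pos (Real.exp_pos _), ← Real.exp_nat_mul, ← Real.exp_sub]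
  congr 2
  ring

/-- The law of large numbers in the form used for the fluid limits: over a number of steps
proportional to the scaling parameter `R`, bounded increments with nonnegative drift add up to at
least `-a R`, except on an event of vanishing probability. -/
lemma tendsto_prob_sum_le (γ : ℝ) (lam : Fin 6 → ℝ≥0) {init : ℕ → State}
    (hinit : ∀ R, (init R).Feasible) {Y : ℕ → State × Tick → ℝ} (hY : ∀ R, Measurable (Y R))
    {C : ℝ} (hC : ∀ R p, |Y R p| ≤ C)
    (h : ∀ᶠ R in atTop, ∀ s : State, s.Feasible → 0 ≤ ∫ x, Y R (s, x) ∂tickLaw lam)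
    (m n : ℕ → ℕ) {K : ℝ} (hn : ∀ R, (n R : ℝ) ≤ K * R) {a : ℝ} (ha : 0 < a) :
    Tendsto (fun R => (ticksLaw lam : Measure (ℕ → Tick))
      {e | ∑ k ∈ Finset.Ico (m R) (n R), Y R (chain γ (init R) e k, e k) ≤ -(a * R)})
      atTop (𝓝 0) := by
  have hC0 : 0 ≤ C := (abs_nonneg _).trans (hC 0 ((fun _ => false, fun _ => 0), (Sum.inl 0, 0)))
  have hK0 : 0 ≤ K := by have := hn 1; push_cast at this; linarith [Nat.cast_nonneg (α := ℝ) (n 1)]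
  -- a tilting parameter for which the linear term of the exponent dominates the quadratic one
  obtain ⟨θ, hθ, hθC, hθa⟩ : ∃ θ : ℝ, 0 < θ ∧ θ * C ≤ 1 ∧ K * (θ * C) ^ 2 < θ * a := by
    refine ⟨min (1 / (C + 1)) (a / (2 * ((C + 1) ^ 2 * (K + 1)))), by positivity, ?_, ?_⟩
    · calc _ ≤ 1 / (C + 1) * C := by gcongr; exact min_le_left _ _
        _ ≤ 1 := by rw [one_div, inv_mul_le_one₀ (by positivity)]; linarith
    · set θ := min (1 / (C + 1)) (a / (2 * ((C + 1) ^ 2 * (K + 1)))) with hθd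
      have hθ : 0 < θ := by positivity
      have h1 : θ * ((C + 1) ^ 2 * (K + 1)) ≤ a / 2 := by
        have h2 : θ ≤ a / (2 * ((C + 1) ^ 2 * (K + 1))) := min_le_right _ _
        rw [le_div_iff₀ (by positivity)] at h2
        linarith
      have h3 : K * C ^ 2 ≤ (C + 1) ^ 2 * (K + 1) := by nlinarith [mul_nonneg hC0 hK0]
      have h4 : θ * (K * C ^ 2) < a := by
        have := mul_le_mul_of_nonneg_left h3 hθ.le
        linarith
      have := mul_lt_mul_of_pos_left h4 hθ
      linarith
  set r := θ * a - K * (θ * C) ^ 2 with hr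
  have hr0 : 0 < r := by linarith
  have hlim : Tendsto (fun R : ℕ => ENNReal.ofReal (Real.exp (-r * R))) atTop (𝓝 0) := by
    rw [← ENNReal.ofReal_zero]
    refine ENNReal.tendsto_ofReal (Real.tendsto_exp_atBot.comp ?_)
    exact tendsto_natCast_atTop_atTop.const_mul_atTop_of_neg (by linarith)
  refine tendsto_of_tendsto_of_tendsto_of_le_of_le' tendsto_const_nhds hlim
    (Eventually.of_forall fun _ => zero_le) ?_
  filter_upwards [h] with R hR
  refine (prob_sum_le γ lam (hinit R) (hY R) (hC R) hR hθ.le hθC _ _ _).trans ?_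
  refine ENNReal.ofReal_le_ofReal (Real.exp_le_exp.2 ?_)
  have := mul_le_mul_of_nonneg_right (hn R) (sq_nonneg (θ * C))
  rw [hr]
  linarith

/-! ### One-step drifts -/

/-- The activity indicator of node `i` as a real number. -/
noncomputable def act (i : Fin 6) (s : State) : ℝ := if s.1 i = true then 1 else 0

/-- The queue length of node `i` as a real number. -/
noncomputable def queue (i : Fin 6) (s : State) : ℝ := s.2 i

/-- The increment of an observable `g` of the state in one step of the chain. -/
noncomputable def incr (γ : ℝ) (g : State → ℝ) (p : State × Tick) : ℝ :=
  g (step γ p.1 p.2) - g p.1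

lemma act_nonneg (i : Fin 6) (s : State) : 0 ≤ act i s := by unfold act; split_ifs <;> norm_num

lemma act_le_one (i : Fin 6) (s : State) : act i s ≤ 1 := by unfold act; split_ifs <;> norm_num

lemma measurable_incr (γ : ℝ) (g : State → ℝ) : Measurable (incr γ g) :=
  ((Measurable.of_discrete (f := g)).comp (measurable_step γ)).sub
    ((Measurable.of_discrete (f := g)).comp measurable_fst)

lemma sum_incr (γ : ℝ) (g : State → ℝ) (s : State) (e : ℕ → Tick) {m n : ℕ} (hmn : m ≤ n) :
    ∑ k ∈ Finset.Ico m n, incr γ g (chain γ s e k, e k) =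
      g (chain γ s e n) - g (chain γ s e m) :=
  Finset.sum_Ico_sub (fun k => g (chain γ s e k)) hmn

lemma abs_incr_act_le (γ : ℝ) (i : Fin 6) (p : State × Tick) : |incr γ (act i) p| ≤ 1 := by
  rw [incr, abs_le]
  constructor <;> linarith [act_nonneg i p.1, act_le_one i p.1, act_nonneg i (step γ p.1 p.2),
    act_le_one i (step γ p.1 p.2)]

lemma abs_incr_queue_le (γ : ℝ) (i : Fin 6) (p : State × Tick) : |incr γ (queue i) p| ≤ 1 := by
  obtain ⟨s, j | j, v⟩ := p
  · rcases eq_or_ne i j with rfl | h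
    · simp [incr, queue, step]
    · simp [incr, queue, step, h]
  · simp only [incr, queue, step]
    by_cases hj : s.1 j = true
    · rw [if_pos hj]
      rcases eq_or_ne i j with rfl | h
      · rcases Nat.eq_zero_or_pos (s.2 i) with h0 | h0
        · simp [h0]
        · simp [Nat.cast_pred h0]
      · simp [h]
    · rw [if_neg hj]
      split_ifs <;> simp

lemma abs_queue_chain_succ_sub_le (γ : ℝ) (s : State) (e : ℕ → Tick) (i : Fin 6) (n : ℕ) :
    |queue i (chain γ s e (n + 1)) - queue i (chain γ s e n)| ≤ 1 :=
  abs_incr_queue_le γ i (chain γ s e n, e n)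

/-- The indicator of a tick of the given type. -/
noncomputable def tickOf (j : Fin 6 ⊕ Fin 6) (x : Tick) : ℝ := if x.1 = j then 1 else 0

lemma measurable_tickOf (j : Fin 6 ⊕ Fin 6) : Measurable (tickOf j) :=
  (Measurable.of_discrete (f := fun k => if k = j then (1 : ℝ) else 0)).comp measurable_fst

lemma integrable_tickOf (lam : Fin 6 → ℝ≥0) (j : Fin 6 ⊕ Fin 6) :
    Integrable (tickOf j) (tickLaw lam) :=
  Integrable.of_bound (measurable_tickOf j).aestronglyMeasurable 1 (ae_of_all _ fun x => by
    unfold tickOf; split_ifs <;> simp)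

lemma clockRate_pos (lam : Fin 6 → ℝ≥0) : 0 < clockRate lam := by
  unfold clockRate; positivity

lemma integral_tickOf (lam : Fin 6 → ℝ≥0) (j : Fin 6 ⊕ Fin 6) :
    ∫ x, tickOf j x ∂tickLaw lam =
      Sum.elim (fun i => (lam i : ℝ)) (fun _ => 1) j / clockRate lam := by
  have h1 : ∫ x, tickOf j x ∂tickLaw lam = (tickLaw lam).real (({j} : Set _) ×ˢ Set.univ) := by
    rw [← integral_indicator_one ((measurableSet_singleton j).prod MeasurableSet.univ)]
    refine integral_congr_ae (ae_of_all _ fun x => ?_)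
    simp [tickOf, Set.indicator]
  rw [h1, tickLaw, Measure.real, Measure.prod_prod, measure_univ, mul_one]
  rcases j with i | i
  · simp only [tickTypeLaw, Measure.coe_add, Measure.coe_finsetSum, Pi.add_apply,
      Finset.sum_apply, Measure.smul_apply, smul_eq_mul, measurableSet_singleton,
      Measure.dirac_apply', Set.indicator_apply, Set.mem_singleton_iff, Pi.one_apply, reduceCtorEq,
      if_false, mul_zero, Finset.sum_const_zero, add_zero, Sum.inl.injEq, mul_ite, mul_one,
      Finset.sum_ite_eq', Finset.mem_univ, if_true]
    simp
  · simp only [tickTypeLaw, Measure.coe_add, Measure.coe_finsetSum, Pi.add_apply,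
      Finset.sum_apply, Measure.smul_apply, smul_eq_mul, measurableSet_singleton,
      Measure.dirac_apply', Set.indicator_apply, Set.mem_singleton_iff, Pi.one_apply, reduceCtorEq,
      if_false, mul_zero, Finset.sum_const_zero, zero_add, Sum.inr.injEq, mul_ite, mul_one,
      Finset.sum_ite_eq', Finset.mem_univ, if_true]
    simp

lemma incr_queue_eq (γ : ℝ) (i : Fin 6) {s : State} (hs : s.Feasible) (x : Tick) :
    incr γ (queue i) (s, x) = tickOf (Sum.inl i) x - act i s * tickOf (Sum.inr i) x := by
  obtain ⟨j | j, v⟩ := x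
  · rcases eq_or_ne i j with rfl | h
    · simp [incr, queue, step, tickOf]
    · simp [incr, queue, step, tickOf, h, h.symm]
  · rcases eq_or_ne i j with rfl | h
    · by_cases hu : s.1 i = true
      · simp [incr, queue, step, tickOf, act, hu, Nat.cast_pred (hs.2 i hu)]
      · simp only [incr, queue, step, tickOf, act, hu]
        split_ifs <;> simp_all
    · simp only [incr, queue, step, tickOf]
      split_ifs <;> simp_all

lemma integrable_incr_queue (γ : ℝ) (lam : Fin 6 → ℝ≥0) (i : Fin 6) (s : State) :
    Integrable (fun x => incr γ (queue i) (s, x)) (tickLaw lam) :=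
  Integrable.of_bound ((measurable_incr γ _).comp measurable_prodMk_left).aestronglyMeasurable 1
    (ae_of_all _ fun _ => abs_incr_queue_le γ i _)

lemma integrable_incr_act (γ : ℝ) (lam : Fin 6 → ℝ≥0) (i : Fin 6) (s : State) :
    Integrable (fun x => incr γ (act i) (s, x)) (tickLaw lam) :=
  Integrable.of_bound ((measurable_incr γ _).comp measurable_prodMk_left).aestronglyMeasurable 1
    (ae_of_all _ fun _ => abs_incr_act_le γ i _)

lemma integral_incr_queue (γ : ℝ) (lam : Fin 6 → ℝ≥0) (i : Fin 6) {s : State}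
    (hs : s.Feasible) :
    ∫ x, incr γ (queue i) (s, x) ∂tickLaw lam = (lam i - act i s) / clockRate lam := by
  simp only [incr_queue_eq γ i hs]
  rw [integral_sub (integrable_tickOf _ _) ((integrable_tickOf _ _).const_mul _),
    integral_const_mul, integral_tickOf, integral_tickOf]
  simp only [Sum.elim_inl, Sum.elim_inr]
  ring

/-! ### Releases of the medium -/

/-- The transitions in which node `b`, holding at least `r` packets, releases the medium. -/
noncomputable def releases (γ : ℝ) (b : Fin 6) (r : ℝ) : Set (State × Tick) :=
  {p | r ≤ queue b p.1 ∧ p.1.1 b = true ∧ (step γ p.1 p.2).1 b = false}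

lemma measurableSet_releases (γ : ℝ) (b : Fin 6) (r : ℝ) : MeasurableSet (releases γ b r) := by
  have h1 : Measurable fun p : State × Tick => (p.1, step γ p.1 p.2) :=
    measurable_fst.prodMk (measurable_step γ)
  exact h1 (MeasurableSet.of_discrete
    (s := {p : State × State | r ≤ queue b p.1 ∧ p.1.1 b = true ∧ p.2.1 b = false}))

lemma volume_unitInterval_le (p : ℝ) :
    (volume : Measure unitInterval) {v | (v : ℝ) ≤ p} ≤ ENNReal.ofReal p := by
  rw [unitInterval.volume_apply]
  refine (measure_mono (t := Set.Icc 0 p) ?_).trans (by simp)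
  rintro _ ⟨v, hv, rfl⟩
  exact ⟨v.2.1, hv⟩

/-- A node with many packets is unlikely to release the medium. -/
lemma tickLaw_releases_le {γ : ℝ} (hγ : 0 ≤ γ) (lam : Fin 6 → ℝ≥0) (b : Fin 6) {r : ℝ}
    (hr : 0 < r) (s : State) :
    tickLaw lam {x | (s, x) ∈ releases γ b r} ≤ ENNReal.ofReal (1 / r ^ γ) := by
  have hsub : {x : Tick | (s, x) ∈ releases γ b r} ⊆
      Set.univ ×ˢ {v : unitInterval | (v : ℝ) ≤ 1 / r ^ γ} := by
    rintro ⟨i | i, v⟩ ⟨h1, h2, h3⟩ <;> change s.1 b = true at h2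
    · simp [step, h2] at h3
    refine ⟨trivial, ?_⟩
    simp only [step] at h3
    simp only [queue] at h1
    split_ifs at h3 with h4 h5 h6
    · rcases eq_or_ne b i with rfl | hb
      · refine h5.trans ?_
        have hpos : 0 < s.2 b := by exact_mod_cast hr.trans_le h1
        simp only [backoffProb, Nat.cast_pred hpos]
        rw [add_sub_cancel]
        gcongr
      · simp [hb, h2] at h3
    · simp [h2] at h3
    · rcases eq_or_ne b i with rfl | hb
      · simp at h3
      · simp [hb, h2] at h3
    · simp [h2] at h3
  refine (measure_mono hsub).trans ?_
  rw [tickLaw, Measure.prod_prod, measure_univ, one_mul]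
  exact volume_unitInterval_le _

/-- An inactive node that can activate does so at the next tick of its clock, and an active one with
at least `r` packets becomes inactive only by a release. The weight `w` is used with
`w = U_a - U_b`, which is positive only if `a` is active and `b` is not. -/
lemma le_incr_act {γ : ℝ} {b : Fin 6} {r : ℝ} {s : State} (hr : r ≤ queue b s) (x : Tick)
    (w : ℝ) (hw : w ≤ 1) (hcan : 0 < w → s.CanActivate b) :
    w * tickOf (Sum.inr b) x - (releases γ b r).indicator 1 (s, x) ≤ incr γ (act b) (s, x) := by
  have hact : act b (step γ s x) = if (step γ s x).1 b = true then 1 else 0 := rfl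
  by_cases h1 : s.1 b = true
  · have hw' : w ≤ 0 := not_lt.1 fun h => by simpa [h1] using (hcan h).2.1
    have ht : 0 ≤ tickOf (Sum.inr b) x := by unfold tickOf; split_ifs <;> norm_num
    have h2 : w * tickOf (Sum.inr b) x ≤ 0 := mul_nonpos_of_nonpos_of_nonneg hw' ht
    by_cases h3 : (step γ s x).1 b = true
    · have : 0 ≤ (releases γ b r).indicator (1 : State × Tick → ℝ) (s, x) :=
        Set.indicator_nonneg (fun _ _ => zero_le_one) _
      simp only [incr, act, h1, h3, if_true]
      linarith
    · have : (s, x) ∈ releases γ b r := ⟨hr, h1, by simpa using h3⟩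
      simp only [incr, act, h1, h3, if_true, Set.indicator_of_mem this]
      simp
      linarith
  · have h2 : (releases γ b r).indicator (1 : State × Tick → ℝ) (s, x) = 0 :=
      Set.indicator_of_notMem (fun h => h1 h.2.1) _
    rw [h2, sub_zero]
    simp only [incr]
    have h0 : act b s = 0 := by simp [act, h1]
    rw [h0, sub_zero]
    by_cases hx : x.1 = Sum.inr b
    · rcases le_or_gt w 0 with hw0 | hw0
      · simpa [tickOf, hx] using hw0.trans (act_nonneg _ _)
      · have : (step γ s x).1 b = true := by
          obtain ⟨j, v⟩ := x
          obtain rfl : j = Sum.inr b := hx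
          simp [step, h1, hcan hw0]
        simpa [tickOf, hx, hact, this] using hw
    · simpa [tickOf, hx] using act_nonneg _ _

/-- Let every neighbour of `b` be a neighbour of `a`. While the queue of `b` is long, the process
`X_a - X_b + U_b` has a drift of almost `(λ_a - λ_b) / β`: whenever `a` is active and `b` is not,
`b` is about to activate. -/
lemma drift_le {γ : ℝ} (hγ : 0 ≤ γ) (lam : Fin 6 → ℝ≥0) {a b : Fin 6}
    (hnbr : ∀ j, graph.Adj b j → graph.Adj a j) {r : ℝ} (hr : 0 < r) {s : State}
    (hs : s.Feasible) (hrs : r ≤ queue b s) :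
    (lam a - lam b : ℝ) / clockRate lam - 1 / r ^ γ ≤
      ∫ x, (incr γ (queue a) (s, x) - incr γ (queue b) (s, x) + incr γ (act b) (s, x))
        ∂tickLaw lam := by
  have hβ : (0 : ℝ) < clockRate lam := clockRate_pos lam
  have hQ : Integrable (fun x => incr γ (queue a) (s, x) - incr γ (queue b) (s, x))
      (tickLaw lam) := (integrable_incr_queue _ _ _ _).sub (integrable_incr_queue _ _ _ _)
  rw [integral_add hQ (integrable_incr_act _ _ _ _), integral_sub (integrable_incr_queue _ _ _ _)
    (integrable_incr_queue _ _ _ _), integral_incr_queue _ _ _ hs, integral_incr_queue _ _ _ hs]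
  set w := act a s - act b s with hw
  have hcan : 0 < w → s.CanActivate b := by
    intro h
    have ha : s.1 a = true := by
      by_contra ha
      have h1 : act a s = 0 := by simp [act, ha]
      linarith [act_nonneg b s]
    have hb : s.1 b = false := by
      by_contra hb
      have h1 : act b s = 1 := by simpa [act] using hb
      linarith [act_le_one a s]
    have h0 : (0 : ℝ) < s.2 b := hr.trans_le hrs
    refine ⟨by exact_mod_cast h0, hb, fun j hj => ?_⟩
    by_contra hj'
    exact hs.1 a j (hnbr j hj) ⟨ha, by simpa using hj'⟩
  have hmeas : MeasurableSet {x : Tick | (s, x) ∈ releases γ b r} :=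
    measurable_prodMk_left (measurableSet_releases γ b r)
  have hint : Integrable (fun x => (releases γ b r).indicator (1 : State × Tick → ℝ) (s, x))
      (tickLaw lam) :=
    Integrable.of_bound ((measurable_one.indicator (measurableSet_releases γ b r)).comp
      measurable_prodMk_left).aestronglyMeasurable 1 (ae_of_all _ fun x => by
        by_cases h : (s, x) ∈ releases γ b r <;> simp [h])
  have h1 : ∫ x, (w * tickOf (Sum.inr b) x -
      (releases γ b r).indicator (1 : State × Tick → ℝ) (s, x)) ∂tickLaw lam ≤
      ∫ x, incr γ (act b) (s, x) ∂tickLaw lam :=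
    integral_mono (((integrable_tickOf _ _).const_mul _).sub hint) (integrable_incr_act _ _ _ _)
      fun x => le_incr_act hrs x w (by linarith [act_le_one a s, act_nonneg b s]) hcan
  rw [integral_sub ((integrable_tickOf _ _).const_mul _) hint, integral_const_mul,
    integral_tickOf, Sum.elim_inr] at h1
  have h2 : ∫ x, (releases γ b r).indicator (1 : State × Tick → ℝ) (s, x) ∂tickLaw lam ≤
      1 / r ^ γ := by
    have h3 : ∫ x, (releases γ b r).indicator (1 : State × Tick → ℝ) (s, x) ∂tickLaw lam =
        (tickLaw lam).real {x : Tick | (s, x) ∈ releases γ b r} :=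
      integral_indicator_one hmeas
    rw [h3]
    exact ENNReal.toReal_le_of_le_ofReal (by positivity) (tickLaw_releases_le hγ lam b hr s)
  have h4 : (lam a - act a s) / clockRate lam - (lam b - act b s) / clockRate lam +
      w * (1 / clockRate lam) = (lam a - lam b : ℝ) / clockRate lam := by
    rw [hw]; ring
  linarith

/-! ### Fluid-scaled paths -/

lemma abs_scaled_queue_sub_le (β : ℝ≥0) {R : ℕ} (hR : 0 < R) (γ : ℝ) (s : State)
    (e : ℕ → Tick) (t : ℝ≥0) (i : Fin 6) :
    |R * Path.Q (scaledPath β R (chain γ s e)) t i -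
      queue i (chain γ s e ⌊β * (R * t)⌋₊)| ≤ 1 := by
  have h1 : (⌊β * (R * t)⌋₊ : ℝ) ≤ (β * (R * t) : ℝ≥0) := by
    exact_mod_cast Nat.floor_le (zero_le (a := β * (R * t)))
  have h2 : ((β * (R * t) : ℝ≥0) : ℝ) < ⌊β * (R * t)⌋₊ + 1 := by
    exact_mod_cast Nat.lt_floor_add_one (β * (R * t))
  have hQ : R * Path.Q (scaledPath β R (chain γ s e)) t i =
      (interp (record (chain γ s e)) (β * (R * t))).1 i := by
    change (R : ℝ) * ((1 / (R : ℝ)) * (interp (record (chain γ s e)) (β * (R * t))).1 i) = _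
    have : (R : ℝ) ≠ 0 := by positivity
    field_simp
  rw [hQ]
  generalize hx : β * (R * t) = x at *
  have h3 := abs_queue_chain_succ_sub_le γ s e i ⌊x⌋₊
  have h4 : (interp (record (chain γ s e)) x).1 i - queue i (chain γ s e ⌊x⌋₊) =
      ((x : ℝ) - ⌊x⌋₊) *
        (queue i (chain γ s e (⌊x⌋₊ + 1)) - queue i (chain γ s e ⌊x⌋₊)) := by
    simp only [interp, record, queue, Prod.fst_add, Prod.smul_fst, Pi.add_apply, Pi.smul_apply,
      smul_eq_mul]
    ring
  rw [h4, abs_mul, abs_of_nonneg (by linarith)]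
  exact mul_le_one₀ (by linarith) (abs_nonneg _) h3

lemma Path.continuous_Q (i : Fin 6) :
    Continuous fun p : Path × ℝ≥0 => Path.Q p.1 p.2 i := by
  unfold Path.Q
  exact (continuous_apply i).comp (continuous_fst.comp continuous_eval)

lemma Path.continuous_Q_left (t : ℝ≥0) (i : Fin 6) : Continuous fun ω : Path => Path.Q ω t i :=
  (Path.continuous_Q i).comp (Continuous.prodMk_left t)

lemma Path.continuous_Q_right (ω : Path) (i : Fin 6) : Continuous fun t => Path.Q ω t i :=
  (Path.continuous_Q i).comp (Continuous.prodMk_right ω)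

/-- An open set of paths is null for a weak limit if the scaled paths lie in it only on events of
vanishing probability. -/
lemma measure_eq_zero_of_isOpen {γ : ℝ} {lam : Fin 6 → ℝ≥0} {init : ℕ → State} {φ : ℕ → ℕ}
    (hφ : StrictMono φ) {μ : ProbabilityMeasure Path}
    (hμ : Tendsto (fun n => scaledLaw γ lam (φ n) (init (φ n))) atTop (𝓝 μ))
    {G : Set Path} (hG : IsOpen G) {S : ℕ → Set (ℕ → Tick)}
    (hS : Tendsto (fun R => (ticksLaw lam : Measure (ℕ → Tick)) (S R)) atTop (𝓝 0))
    (h : ∀ᶠ R in atTop, ∀ e, scaledPath (clockRate lam) R (chain γ (init R) e) ∈ G → e ∈ S R) :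
    (μ : Measure Path) G = 0 := by
  refine le_antisymm ?_ zero_le
  refine (ProbabilityMeasure.le_liminf_measure_open_of_tendsto hμ hG).trans ?_
  refine le_of_eq (Tendsto.liminf_eq ?_)
  refine tendsto_of_tendsto_of_tendsto_of_le_of_le' tendsto_const_nhds
    (hS.comp hφ.tendsto_atTop) (Eventually.of_forall fun _ => zero_le) ?_
  filter_upwards [hφ.tendsto_atTop.eventually h] with n hn
  have hm : Measurable fun e => scaledPath (clockRate lam) (φ n) (chain γ (init (φ n)) e) :=
    (continuous_scaledPath _ _).measurable.comp (measurable_chain γ _)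
  have : (scaledLaw γ lam (φ n) (init (φ n)) : Measure Path) =
      (ticksLaw lam : Measure (ℕ → Tick)).map
        fun e => scaledPath (clockRate lam) (φ n) (chain γ (init (φ n)) e) := rfl
  rw [this, Measure.map_apply hm hG.measurableSet]
  exact measure_mono fun e he => hn e he

/-! ### Growth of a dominating queue -/

lemma tendsto_one_div_mul_rpow {γ : ℝ} (hγ : 0 < γ) {c : ℝ} (hc : 0 < c) :
    Tendsto (fun R : ℕ => 1 / (c * R) ^ γ) atTop (𝓝 0) := by
  simp only [one_div]
  exact tendsto_inv_atTop_zero.comp ((tendsto_rpow_atTop hγ).comp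
    (tendsto_natCast_atTop_atTop.const_mul_atTop hc))

/-- Since `γ > 1`, a queue of order `R` does not release the medium within a time of order `R`. -/
lemma tendsto_prob_releases {γ : ℝ} (hγ : 1 < γ) (lam : Fin 6 → ℝ≥0) {init : ℕ → State}
    (hinit : ∀ R, (init R).Feasible) (b : Fin 6) {c : ℝ} (hc : 0 < c) (n : ℕ → ℕ) {K : ℝ}
    (hn : ∀ R, (n R : ℝ) ≤ K * R) :
    Tendsto (fun R : ℕ => (ticksLaw lam : Measure (ℕ → Tick))
      {e | ∃ k < n R, (chain γ (init R) e k, e k) ∈ releases γ b (c * R)}) atTop (𝓝 0) := by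
  have hlim : Tendsto (fun R : ℕ => ENNReal.ofReal (K / c * (1 / (c * R) ^ (γ - 1))))
      atTop (𝓝 0) := by
    rw [← ENNReal.ofReal_zero]
    refine ENNReal.tendsto_ofReal ?_
    simpa using (tendsto_one_div_mul_rpow (sub_pos.2 hγ) hc).const_mul (K / c)
  refine tendsto_of_tendsto_of_tendsto_of_le_of_le' tendsto_const_nhds hlim
    (Eventually.of_forall fun _ => zero_le) ?_
  filter_upwards [eventually_gt_atTop 0] with R hR
  have hR' : (0 : ℝ) < R := by exact_mod_cast hR
  have hcR : 0 < c * R := by positivity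
  refine (prob_exists_le γ lam (hinit R) (measurableSet_releases γ b _)
    (fun s _ => tickLaw_releases_le (by linarith) lam b hcR s) (n R)).trans ?_
  rw [← ENNReal.ofReal_natCast, ← ENNReal.ofReal_mul (by positivity)]
  refine ENNReal.ofReal_le_ofReal ?_
  calc (n R : ℝ) * (1 / (c * R) ^ γ) ≤ K * R * (1 / (c * R) ^ γ) := by
        gcongr; exact hn R
    _ = K / c * (1 / (c * R) ^ (γ - 1)) := by
        rw [Real.rpow_sub_one hcR.ne']
        field_simp

/-- The increments of `X_a - X_b + U_b` while the queue of `b` holds at least `r` packets, centred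
so that they have a nonnegative drift for large `r`. The uncentred drift tends to
`(λ_a - λ_b) / β` as `r → ∞`, which leaves room for any factor below one in place of `3 / 4`. -/
noncomputable def growthIncr (γ : ℝ) (lam : Fin 6 → ℝ≥0) (a b : Fin 6) (r : ℝ) :
    State × Tick → ℝ :=
  {p | r ≤ queue b p.1}.indicator fun p =>
    incr γ (queue a) p - incr γ (queue b) p + incr γ (act b) p -
      3 / 4 * ((lam a - lam b : ℝ) / clockRate lam)

lemma sum_growthIncr {γ : ℝ} {lam : Fin 6 → ℝ≥0} {a b : Fin 6} {r : ℝ} {s : State}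
    {e : ℕ → Tick} {m n : ℕ} (hmn : m ≤ n)
    (h : ∀ k ∈ Finset.Ico m n, r ≤ queue b (chain γ s e k)) :
    ∑ k ∈ Finset.Ico m n, growthIncr γ lam a b r (chain γ s e k, e k) =
      (queue a (chain γ s e n) - queue a (chain γ s e m)) -
        (queue b (chain γ s e n) - queue b (chain γ s e m)) +
        (act b (chain γ s e n) - act b (chain γ s e m)) -
        (n - m) * (3 / 4 * ((lam a - lam b : ℝ) / clockRate lam)) := by
  have h' : ∀ k ∈ Finset.Ico m n, growthIncr γ lam a b r (chain γ s e k, e k) =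
      incr γ (queue a) (chain γ s e k, e k) - incr γ (queue b) (chain γ s e k, e k) +
        incr γ (act b) (chain γ s e k, e k) - 3 / 4 * ((lam a - lam b : ℝ) / clockRate lam) :=
    fun k hk => Set.indicator_of_mem (s := {p : State × Tick | r ≤ queue b p.1}) (h k hk) _
  rw [← sum_incr γ (queue a) s e hmn, ← sum_incr γ (queue b) s e hmn,
    ← sum_incr γ (act b) s e hmn, ← Finset.sum_sub_distrib, ← Finset.sum_add_distrib,
    Finset.sum_congr rfl h', Finset.sum_sub_distrib, Finset.sum_const, Nat.card_Ico, nsmul_eq_mul,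
    Nat.cast_sub hmn]

/-- With high probability, `X_a - X_b + U_b` grows at the rate of its centring as long as the queue
of `b` is of order `R`. -/
lemma tendsto_prob_sum_growthIncr {γ : ℝ} (hγ : 0 < γ) {lam : Fin 6 → ℝ≥0} {init : ℕ → State}
    (hinit : ∀ R, (init R).Feasible) {a b : Fin 6} (hnbr : ∀ j, graph.Adj b j → graph.Adj a j)
    (hlam : lam b < lam a) {c : ℝ} (hc : 0 < c) (m n : ℕ → ℕ) {K : ℝ}
    (hn : ∀ R, (n R : ℝ) ≤ K * R) {α : ℝ} (hα : 0 < α) :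
    Tendsto (fun R : ℕ => (ticksLaw lam : Measure (ℕ → Tick))
      {e | ∑ k ∈ Finset.Ico (m R) (n R),
        growthIncr γ lam a b (c * R) (chain γ (init R) e k, e k) ≤ -(α * R)}) atTop (𝓝 0) := by
  have hβ : (0 : ℝ) < clockRate lam := clockRate_pos lam
  have hlam' : (lam b : ℝ) < lam a := hlam
  have hd : 0 < (lam a - lam b : ℝ) / clockRate lam := div_pos (by linarith) hβ
  set d := (lam a - lam b : ℝ) / clockRate lam with hddef
  refine tendsto_prob_sum_le γ lam hinit (Y := fun R => growthIncr γ lam a b (c * R))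
    (C := 3 + d) (fun R => ?_) (fun R p => ?_) ?_ m n hn hα
  · refine Measurable.indicator ?_ (measurable_fst (MeasurableSet.of_discrete
      (s := {s : State | c * R ≤ queue b s})))
    exact (((measurable_incr _ _).sub (measurable_incr _ _)).add (measurable_incr _ _)).sub_const _
  · refine (norm_indicator_le_norm_self (E := ℝ)
        (s := {p : State × Tick | c * R ≤ queue b p.1}) _ p).trans ?_
    have h1 := abs_le.1 (abs_incr_queue_le γ a p)
    have h2 := abs_le.1 (abs_incr_queue_le γ b p)
    have h3 := abs_le.1 (abs_incr_act_le γ b p)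
    rw [Real.norm_eq_abs, abs_le]
    constructor <;> linarith [h1.1, h1.2, h2.1, h2.2, h3.1, h3.2]
  · filter_upwards [eventually_gt_atTop 0, (tendsto_one_div_mul_rpow hγ hc).eventually_lt_const
      (show 0 < d / 4 by positivity)] with R hR hRd s hs
    have hR' : (0 : ℝ) < R := by exact_mod_cast hR
    by_cases hb : c * R ≤ queue b s
    · have h1 : ∀ x, growthIncr γ lam a b (c * R) (s, x) = incr γ (queue a) (s, x) -
          incr γ (queue b) (s, x) + incr γ (act b) (s, x) - 3 / 4 * d := fun x =>
        Set.indicator_of_mem (s := {p : State × Tick | c * R ≤ queue b p.1})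
          (show (s, x) ∈ {p : State × Tick | c * R ≤ queue b p.1} from hb) _
      have hint : Integrable (fun x => incr γ (queue a) (s, x) - incr γ (queue b) (s, x) +
          incr γ (act b) (s, x)) (tickLaw lam) :=
        ((integrable_incr_queue _ _ _ _).sub (integrable_incr_queue _ _ _ _)).add
          (integrable_incr_act _ _ _ _)
      have h2 := drift_le hγ.le lam hnbr (by positivity) hs hb
      simp only [h1]
      rw [integral_sub hint (integrable_const _)]
      simp only [integral_const, probReal_univ, smul_eq_mul, one_mul]
      linarith
    · have h1 : ∀ x, growthIncr γ lam a b (c * R) (s, x) = 0 := fun x =>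
        Set.indicator_of_notMem (s := {p : State × Tick | c * R ≤ queue b p.1})
          (show (s, x) ∉ {p : State × Tick | c * R ≤ queue b p.1} from hb) _
      simp [h1]

lemma floor_le_mul (β t : ℝ≥0) (R : ℕ) : (⌊β * (R * t)⌋₊ : ℝ) ≤ β * t * R := by
  have : (⌊β * (R * t)⌋₊ : ℝ) ≤ (β * (R * t) : ℝ≥0) := by
    exact_mod_cast Nat.floor_le (zero_le (a := β * (R * t)))
  push_cast at this
  linarith

lemma mul_lt_floor_add_one (β t : ℝ≥0) (R : ℕ) : β * t * R < (⌊β * (R * t)⌋₊ : ℝ) + 1 := by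
  have : ((β * (R * t) : ℝ≥0) : ℝ) < ⌊β * (R * t)⌋₊ + 1 := by
    exact_mod_cast Nat.lt_floor_add_one (β * (R * t))
  push_cast at this
  linarith

/-- Every step between two scaled times is the step of an intermediate scaled time. -/
lemma exists_floor_eq {β : ℝ≥0} (hβ : 0 < β) {R : ℕ} (hR : 0 < R) {s t : ℝ≥0} {k : ℕ}
    (hs : ⌊β * (R * s)⌋₊ ≤ k) (ht : k ≤ ⌊β * (R * t)⌋₊) (hst : s ≤ t) :
    ∃ u ∈ Set.Icc s t, ⌊β * (R * u)⌋₊ = k := by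
  have hR' : (0 : ℝ≥0) < R := by exact_mod_cast hR
  rcases le_total ((k : ℝ≥0) / (β * R)) s with h | h
  · refine ⟨s, ⟨le_rfl, hst⟩, le_antisymm hs (Nat.le_floor ?_)⟩
    rw [div_le_iff₀ (by positivity)] at h
    exact h.trans (le_of_eq (by ring))
  · refine ⟨(k : ℝ≥0) / (β * R), ⟨h, ?_⟩, ?_⟩
    · rw [div_le_iff₀ (by positivity)]
      exact ((Nat.le_floor_iff zero_le).1 ht).trans (le_of_eq (by ring))
    · have : β * (R * ((k : ℝ≥0) / (β * R))) = k := by field_simp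
      rw [this, Nat.floor_natCast]

lemma eventually_le_mul_natCast {c : ℝ} (hc : 0 < c) (A : ℝ) : ∀ᶠ R : ℕ in atTop, A ≤ c * R :=
  (tendsto_natCast_atTop_atTop.const_mul_atTop hc).eventually_ge_atTop A

section FluidLimit

variable {γ : ℝ} {lam : Fin 6 → ℝ≥0} {init : ℕ → State} {φ : ℕ → ℕ} {μ : ProbabilityMeasure Path}

/-- The portmanteau theorem applied to the paths on which `Q_b` stays above `ε` and `Q_a - Q_b`
grows too slowly. The rate `(λ_a - λ_b) / 2` in place of `3 (λ_a - λ_b) / 4` absorbs the error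
terms. -/
lemma growth_null (hγ : 0 < γ) (hinit : ∀ R, (init R).Feasible) (hφ : StrictMono φ)
    (hμ : Tendsto (fun n => scaledLaw γ lam (φ n) (init (φ n))) atTop (𝓝 μ)) {a b : Fin 6}
    (hnbr : ∀ j, graph.Adj b j → graph.Adj a j) (hlam : lam b < lam a) {s t : ℝ≥0} (hst : s < t)
    {ε : ℝ} (hε : 0 < ε) :
    (μ : Measure Path) {ω | (∀ u ∈ Set.Icc s t, ε < Path.Q ω u b) ∧
      (Path.Q ω t a - Path.Q ω t b) - (Path.Q ω s a - Path.Q ω s b) <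
        (lam a - lam b) / 2 * (t - s)} = 0 := by
  set β := clockRate lam with hβdef
  have hβ : (0 : ℝ) < β := clockRate_pos lam
  have hlam' : (lam b : ℝ) < lam a := hlam
  have hst' : (s : ℝ) < t := hst
  set D : ℝ := lam a - lam b with hD
  have hD0 : 0 < D := by linarith
  have hα : 0 < D * (t - s) / 8 := by have : (0 : ℝ) < t - s := by linarith
                                      positivity
  refine measure_eq_zero_of_isOpen hφ hμ ?_ (tendsto_prob_sum_growthIncr hγ hinit hnbr hlam
    (half_pos hε) (fun R => ⌊β * (R * s)⌋₊) (fun R => ⌊β * (R * t)⌋₊)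
    (fun R => floor_le_mul β t R) hα) ?_
  · refine IsOpen.inter ?_ ?_
    · have h := ContinuousMap.isOpen_setOfPred_mapsTo (isCompact_Icc (a := s) (b := t))
        (isOpen_lt continuous_const ((continuous_apply b).comp continuous_fst) :
          IsOpen {x : Phase | ε < x.1 b})
      exact h
    · have h := fun u i => Path.continuous_Q_left u i
      exact isOpen_lt (((h t a).sub (h t b)).sub ((h s a).sub (h s b))) continuous_const
  · filter_upwards [eventually_gt_atTop 0, eventually_le_mul_natCast (half_pos hε) 1,
      eventually_le_mul_natCast hα (5 + 3 / 4 * (D / β))] with R hR h1 h2 e ⟨he1, he2⟩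
    have hR' : (0 : ℝ) < R := by exact_mod_cast hR
    have hval := fun u i => abs_le.1 (abs_scaled_queue_sub_le β hR γ (init R) e u i)
    set m := ⌊β * (R * s)⌋₊ with hm
    set n := ⌊β * (R * t)⌋₊ with hn
    have hmn : m ≤ n := Nat.floor_mono (by gcongr)
    have hlow : ∀ k ∈ Finset.Ico m n, ε / 2 * R ≤ queue b (chain γ (init R) e k) := by
      intro k hk
      obtain ⟨hk1, hk2⟩ := Finset.mem_Ico.1 hk
      obtain ⟨u, hu, rfl⟩ := exists_floor_eq (clockRate_pos lam) hR hk1 hk2.le hst.le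
      have h3 := mul_lt_mul_of_pos_left (he1 u hu) hR'
      linarith [(hval u b).2]
    change ∑ k ∈ Finset.Ico m n, _ ≤ _
    rw [sum_growthIncr hmn hlow]
    have h4 := mul_lt_mul_of_pos_left he2 hR'
    have h5 : β * (t - s) * R - 1 < (n : ℝ) - m := by
      linarith [floor_le_mul β s R, mul_lt_floor_add_one β t R]
    have h6 : (β * (t - s) * R - 1) * (3 / 4 * (D / β)) ≤ (n - m) * (3 / 4 * (D / β)) :=
      mul_le_mul_of_nonneg_right h5.le (by positivity)
    have h7 : (β * (t - s) * R - 1) * (3 / 4 * (D / β)) =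
        3 / 4 * D * (t - s) * R - 3 / 4 * (D / β) := by
      field_simp
    have h8 := act_nonneg b (chain γ (init R) e m)
    have h9 := act_le_one b (chain γ (init R) e n)
    linarith [(hval t a).1, (hval t b).2, (hval s a).2, (hval s b).1]

/-- Almost surely, `Q_a - Q_b` grows at least linearly as long as `Q_b` is positive. -/
lemma ae_growth (hγ : 0 < γ) (hinit : ∀ R, (init R).Feasible) (hφ : StrictMono φ)
    (hμ : Tendsto (fun n => scaledLaw γ lam (φ n) (init (φ n))) atTop (𝓝 μ)) {a b : Fin 6}
    (hnbr : ∀ j, graph.Adj b j → graph.Adj a j) (hlam : lam b < lam a) :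
    ∀ᵐ ω ∂(μ : Measure Path), ∀ s t : ℝ≥0, s < t → (∀ u ∈ Set.Ioo s t, 0 < Path.Q ω u b) →
      (lam a - lam b : ℝ) / 2 * (t - s) ≤
        (Path.Q ω t a - Path.Q ω t b) - (Path.Q ω s a - Path.Q ω s b) := by
  obtain ⟨A, hAc, hAd⟩ := TopologicalSpace.exists_countable_dense ℝ≥0
  have hall : ∀ᵐ ω ∂(μ : Measure Path), ∀ s ∈ A, ∀ t ∈ A, s < t → ∀ n : ℕ,
      ¬ ((∀ u ∈ Set.Icc s t, 1 / ((n : ℝ) + 1) < Path.Q ω u b) ∧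
      (Path.Q ω t a - Path.Q ω t b) - (Path.Q ω s a - Path.Q ω s b) <
        (lam a - lam b) / 2 * (t - s)) := by
    rw [ae_ball_iff hAc]
    intro s _
    rw [ae_ball_iff hAc]
    intro t _
    by_cases hst : s < t
    · simp only [hst, true_imp_iff]
      rw [ae_all_iff]
      intro n
      exact measure_eq_zero_iff_ae_notMem.1
        (growth_null hγ hinit hφ hμ hnbr hlam hst (by positivity))
    · simp [hst]
  filter_upwards [hall] with ω hω s t hst hpos
  obtain ⟨w, hsw, hwt⟩ := exists_between hst
  obtain ⟨x, _, hx, hxlim⟩ := Dense.exists_seq_strictAnti_tendsto_of_lt hAd hsw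
  obtain ⟨y, _, hy, hylim⟩ := Dense.exists_seq_strictMono_tendsto_of_lt hAd hwt
  have hc := fun i => Path.continuous_Q_right ω i
  have hlimx := fun i => ((hc i).tendsto s).comp hxlim
  have hlimy := fun i => ((hc i).tendsto t).comp hylim
  have hlim1 : Tendsto (fun n => (lam a - lam b : ℝ) / 2 * (y n - x n)) atTop
      (𝓝 ((lam a - lam b : ℝ) / 2 * (t - s))) :=
    (((NNReal.tendsto_coe.2 hylim).sub (NNReal.tendsto_coe.2 hxlim)).const_mul _)
  refine le_of_tendsto_of_tendsto' hlim1
    (((hlimy a).sub (hlimy b)).sub ((hlimx a).sub (hlimx b))) fun n => ?_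
  have hxy : x n < y n := (hx n).1.2.trans (hy n).1.1
  obtain ⟨u, hu, hmin⟩ := isCompact_Icc.exists_isMinOn (Set.nonempty_Icc.2 hxy.le)
    (hc b).continuousOn
  obtain ⟨k, hk⟩ := exists_nat_one_div_lt
    (hpos u ⟨(hx n).1.1.trans_le hu.1, hu.2.trans_lt (hy n).1.2⟩)
  by_contra hlt
  exact hω _ (hx n).2 _ (hy n).2 hxy k
    ⟨fun v hv => hk.trans_le (hmin hv), not_le.1 hlt⟩

/-! ### Initial condition and nonnegativity -/

lemma ae_nonneg (hφ : StrictMono φ)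
    (hμ : Tendsto (fun n => scaledLaw γ lam (φ n) (init (φ n))) atTop (𝓝 μ)) :
    ∀ᵐ ω ∂(μ : Measure Path), ∀ t i, 0 ≤ Path.Q ω t i := by
  have hall : ∀ᵐ ω ∂(μ : Measure Path), ∀ n : ℕ,
      ω ∉ {ω | ∃ t i, Path.Q ω t i < -(1 / ((n : ℝ) + 1))} := by
    rw [ae_all_iff]
    intro n
    refine measure_eq_zero_iff_ae_notMem.1 (measure_eq_zero_of_isOpen hφ hμ
      (S := fun _ => ∅) ?_ (by simp) ?_)
    · simp only [Set.ofPred_exists]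
      exact isOpen_iUnion fun t => isOpen_iUnion fun i =>
        isOpen_lt (Path.continuous_Q_left t i) continuous_const
    · filter_upwards [eventually_gt_atTop 0, eventually_le_mul_natCast
        (show 0 < 1 / ((n : ℝ) + 1) by positivity) 1] with R hR h1 e ⟨t, i, hti⟩
      have hR' : (0 : ℝ) < R := by exact_mod_cast hR
      have h2 := (abs_le.1 (abs_scaled_queue_sub_le (clockRate lam) hR γ (init R) e t i)).1
      have h3 : 0 ≤ queue i (chain γ (init R) e ⌊clockRate lam * (R * t)⌋₊) := Nat.cast_nonneg _
      have h4 := mul_lt_mul_of_pos_left hti hR'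
      linarith
  filter_upwards [hall] with ω hω t i
  by_contra! h
  obtain ⟨n, hn⟩ := exists_nat_one_div_lt (neg_pos.2 h)
  exact hω n ⟨t, i, by linarith⟩

lemma ae_initial (hφ : StrictMono φ)
    (hμ : Tendsto (fun n => scaledLaw γ lam (φ n) (init (φ n))) atTop (𝓝 μ)) {i : Fin 6} {x : ℝ}
    (hx : Tendsto (fun R : ℕ => ((init R).2 i : ℝ) / R) atTop (𝓝 x)) :
    ∀ᵐ ω ∂(μ : Measure Path), Path.Q ω 0 i = x := by
  have hall : ∀ᵐ ω ∂(μ : Measure Path), ∀ n : ℕ,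
      ω ∉ {ω | 1 / ((n : ℝ) + 1) < |Path.Q ω 0 i - x|} := by
    rw [ae_all_iff]
    intro n
    have hε : 0 < 1 / ((n : ℝ) + 1) := by positivity
    refine measure_eq_zero_iff_ae_notMem.1 (measure_eq_zero_of_isOpen hφ hμ
      (S := fun _ => ∅) ?_ (by simp) ?_)
    · exact isOpen_lt continuous_const ((Path.continuous_Q_left 0 i).sub continuous_const).abs
    · filter_upwards [eventually_gt_atTop 0, eventually_le_mul_natCast (half_pos hε) 1,
        Metric.tendsto_nhds.1 hx _ (half_pos hε)] with R hR h1 h2 e he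
      have hR' : (0 : ℝ) < R := by exact_mod_cast hR
      have h3 := abs_scaled_queue_sub_le (clockRate lam) hR γ (init R) e 0 i
      simp only [mul_zero, Nat.floor_zero, chain] at h3
      have h4 : |Path.Q (scaledPath (clockRate lam) R (chain γ (init R) e)) 0 i -
          (init R).2 i / R| ≤ 1 / R := by
        rw [le_div_iff₀ hR', ← abs_of_pos hR', ← abs_mul, abs_of_pos hR']
        refine le_of_eq_of_le ?_ h3
        congr 1
        simp only [queue]
        field_simp
      have h5 : 1 / (R : ℝ) ≤ 1 / ((n : ℝ) + 1) / 2 := by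
        rw [div_le_iff₀ hR']; exact h1
      rw [Real.dist_eq] at h2
      have h6 := abs_sub_le (Path.Q (scaledPath (clockRate lam) R (chain γ (init R) e)) 0 i)
        ((init R).2 i / R) x
      have h7 : _ < _ := he
      linarith
  filter_upwards [hall] with ω hω
  by_contra h
  obtain ⟨n, hn⟩ := exists_nat_one_div_lt (abs_pos.2 (sub_ne_zero.2 h))
  exact hω n hn

/-! ### The workload of a clique -/

/-- The workload of a clique of three nodes decreases at most at rate `1 - ℓ`, where `ℓ` is its
load: at most one of its nodes is active at a time. -/
lemma ae_workload (hinit : ∀ R, (init R).Feasible) (hφ : StrictMono φ)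
    (hμ : Tendsto (fun n => scaledLaw γ lam (φ n) (init (φ n))) atTop (𝓝 μ)) {x y z : Fin 6}
    (hxy : graph.Adj x y) (hyz : graph.Adj y z) (hxz : graph.Adj x z) {s t : ℝ≥0} (hst : s ≤ t) :
    ∀ᵐ ω ∂(μ : Measure Path),
      Path.Q ω s x + Path.Q ω s y + Path.Q ω s z - (1 - (lam x + lam y + lam z)) * (t - s) ≤
        Path.Q ω t x + Path.Q ω t y + Path.Q ω t z := by
  set β := clockRate lam with hβdef
  have hβ : (0 : ℝ) < β := clockRate_pos lam
  set d : ℝ := lam x + lam y + lam z - 1 with hd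
  have hall : ∀ᵐ ω ∂(μ : Measure Path), ∀ n : ℕ,
      ω ∉ {ω | (Path.Q ω t x + Path.Q ω t y + Path.Q ω t z) -
        (Path.Q ω s x + Path.Q ω s y + Path.Q ω s z) < d * (t - s) - 1 / ((n : ℝ) + 1)} := by
    rw [ae_all_iff]
    intro n
    have hε : 0 < 1 / ((n : ℝ) + 1) := by positivity
    set ε := 1 / ((n : ℝ) + 1)
    have hlim := tendsto_prob_sum_le γ lam hinit
      (Y := fun _ p => incr γ (queue x) p + incr γ (queue y) p + incr γ (queue z) p - d / β)
      (C := 3 + |d / β|)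
      (fun _ => (((measurable_incr _ _).add (measurable_incr _ _)).add
        (measurable_incr _ _)).sub_const _)
      (fun _ p => by
        have h1 := abs_le.1 (abs_incr_queue_le γ x p)
        have h2 := abs_le.1 (abs_incr_queue_le γ y p)
        have h3 := abs_le.1 (abs_incr_queue_le γ z p)
        have h4 := abs_le.1 (le_refl |d / β|)
        rw [abs_le]
        constructor <;> linarith [h1.1, h1.2, h2.1, h2.2, h3.1, h3.2, h4.1, h4.2])
      (Eventually.of_forall fun _ s hs => by
        have hi := fun i => integrable_incr_queue γ lam i s
        have h12 : Integrable (fun v => incr γ (queue x) (s, v) + incr γ (queue y) (s, v))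
          (tickLaw lam) := (hi x).add (hi y)
        have h123 : Integrable (fun v => incr γ (queue x) (s, v) + incr γ (queue y) (s, v) +
          incr γ (queue z) (s, v)) (tickLaw lam) := h12.add (hi z)
        have hact : act x s + act y s + act z s ≤ 1 := by
          have h1 := hs.1 x y hxy
          have h2 := hs.1 y z hyz
          have h3 := hs.1 x z hxz
          unfold act
          by_cases hx : s.1 x = true <;> by_cases hy : s.1 y = true <;>
            by_cases hz : s.1 z = true <;> simp_all
        rw [integral_sub h123 (integrable_const _), integral_add h12 (hi z),
          integral_add (hi x) (hi y), integral_incr_queue _ _ _ hs, integral_incr_queue _ _ _ hs,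
          integral_incr_queue _ _ _ hs]
        simp only [integral_const, probReal_univ, smul_eq_mul, one_mul]
        rw [← add_div, ← add_div, ← sub_div]
        refine div_nonneg ?_ hβ.le
        rw [hd]
        linarith)
      (fun R => ⌊β * (R * s)⌋₊) (fun R => ⌊β * (R * t)⌋₊)
      (fun R => floor_le_mul β t R) (half_pos hε)
    refine measure_eq_zero_iff_ae_notMem.1 (measure_eq_zero_of_isOpen hφ hμ ?_ hlim ?_)
    · have h := fun u i => Path.continuous_Q_left u i
      exact isOpen_lt ((((h t x).add (h t y)).add (h t z)).sub
        (((h s x).add (h s y)).add (h s z))) continuous_const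
    · filter_upwards [eventually_gt_atTop 0,
        eventually_le_mul_natCast (half_pos hε) (6 + |d / β|)] with R hR h1 e he
      have hR' : (0 : ℝ) < R := by exact_mod_cast hR
      have hval := fun u i => abs_le.1 (abs_scaled_queue_sub_le β hR γ (init R) e u i)
      set m := ⌊β * (R * s)⌋₊ with hm
      set n := ⌊β * (R * t)⌋₊ with hn
      have hmn : m ≤ n := Nat.floor_mono (by gcongr)
      change ∑ k ∈ Finset.Ico m n, _ ≤ _
      rw [Finset.sum_sub_distrib, Finset.sum_add_distrib, Finset.sum_add_distrib,
        sum_incr _ _ _ _ hmn, sum_incr _ _ _ _ hmn, sum_incr _ _ _ _ hmn, Finset.sum_const,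
        Nat.card_Ico, nsmul_eq_mul, Nat.cast_sub hmn]
      have h4 := mul_lt_mul_of_pos_left (show _ < _ from he) hR'
      -- the number of steps differs from `β (t - s) R` by at most one
      have h5 : |β * (t - s) * R - ((n : ℝ) - m)| ≤ 1 := by
        rw [abs_le]
        constructor <;> linarith [floor_le_mul β s R, mul_lt_floor_add_one β t R,
          floor_le_mul β t R, mul_lt_floor_add_one β s R]
      have h6 : |(β * (t - s) * R - ((n : ℝ) - m)) * (d / β)| ≤ |d / β| := by
        rw [abs_mul]
        exact mul_le_of_le_one_left (abs_nonneg _) h5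
      have h7 : (β * (t - s) * R) * (d / β) = d * (t - s) * R := by
        field_simp
      linarith [(abs_le.1 h6).2, (hval t x).1, (hval t y).1, (hval t z).1, (hval s x).2,
        (hval s y).2, (hval s z).2]
  filter_upwards [hall] with ω hω
  by_contra! h
  obtain ⟨n, hn⟩ := exists_nat_one_div_lt (sub_pos.2 h)
  refine hω n ?_
  rw [hd]
  linarith

/-! ### A long queue outside the clique feeds the clique -/

/-- Suppose `b` has a queue of order `R`. With high probability it does not release the medium for
a time of order `R`. Either it is inactive up to time `δ / 2`; then `a`, whose activity would let
`b` activate, is inactive most of that time and its queue grows. Or `b` is active during all of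
`[δ / 2, δ]` and the queue of its neighbour `z` grows. The bound on `δ` keeps the queue of `b`
above half of its initial length, as at most `β δ R` packets leave in the meantime. -/
lemma ae_feed (hγ : 1 < γ) (hinit : ∀ R, (init R).Feasible) (hφ : StrictMono φ)
    (hμ : Tendsto (fun n => scaledLaw γ lam (φ n) (init (φ n))) atTop (𝓝 μ)) {a b z : Fin 6}
    (hnbr : ∀ j, graph.Adj b j → graph.Adj a j) (hbz : graph.Adj b z) (hlam : lam b < lam a)
    {q : ℝ} (hq : 0 < q)
    (hx : Tendsto (fun R : ℕ => ((init R).2 b : ℝ) / R) atTop (𝓝 q)) {δ : ℝ≥0}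
    (hδq : 4 * clockRate lam * δ ≤ q) {η : ℝ} (hη : 0 < η) (hηa : 8 * η ≤ (lam a - lam b) * δ)
    (hηz : 8 * η ≤ lam z * δ) :
    ∀ᵐ ω ∂(μ : Measure Path), η ≤ Path.Q ω (δ / 2) a ∨ η ≤ Path.Q ω δ z := by
  set β := clockRate lam with hβdef
  have hβ : (0 : ℝ) < β := clockRate_pos lam
  set c : ℝ := 3 / 4 * ((lam a - lam b : ℝ) / β) with hc
  have hc0 : 0 ≤ c := by
    have : (lam b : ℝ) ≤ lam a := hlam.le
    have : (0 : ℝ) ≤ lam a - lam b := by linarith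
    positivity
  have hz0 : 0 ≤ (lam z : ℝ) / β := by positivity
  have h1 := tendsto_prob_sum_growthIncr (zero_lt_one.trans hγ) hinit hnbr hlam (half_pos hq)
    (fun _ => 0) (fun R => ⌊β * (R * (δ / 2))⌋₊) (fun R => floor_le_mul β (δ / 2) R) hη
  have h2 := tendsto_prob_sum_le γ lam hinit
    (Y := fun _ => {p : State × Tick | p.1.1 b = true}.indicator fun p =>
      incr γ (queue z) p - lam z / β)
    (C := 1 + lam z / β)
    (fun _ => ((measurable_incr _ _).sub_const _).indicator
      (measurable_fst (MeasurableSet.of_discrete (s := {s : State | s.1 b = true}))))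
    (fun _ p => by
      refine (norm_indicator_le_norm_self (E := ℝ)
        (s := {p : State × Tick | p.1.1 b = true}) _ p).trans ?_
      have h1 := abs_le.1 (abs_incr_queue_le γ z p)
      rw [Real.norm_eq_abs, abs_le]
      constructor <;> linarith [h1.1, h1.2])
    (Eventually.of_forall fun _ s hs => by
      by_cases hb : s.1 b = true
      · have hz : act z s = 0 := by
          have : s.1 z ≠ true := fun h => hs.1 b z hbz ⟨hb, h⟩
          simp [act, this]
        have h3 : ∀ x, {p : State × Tick | p.1.1 b = true}.indicator (fun p =>
            incr γ (queue z) p - lam z / β) (s, x) = incr γ (queue z) (s, x) - lam z / β :=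
          fun x => Set.indicator_of_mem (s := {p : State × Tick | p.1.1 b = true})
            (show (s, x) ∈ {p : State × Tick | p.1.1 b = true} from hb) _
        simp only [h3]
        rw [integral_sub (integrable_incr_queue _ _ _ _) (integrable_const _),
          integral_incr_queue _ _ _ hs, hz]
        simp [hβdef]
      · have h3 : ∀ x, {p : State × Tick | p.1.1 b = true}.indicator (fun p =>
            incr γ (queue z) p - lam z / β) (s, x) = 0 :=
          fun x => Set.indicator_of_notMem (s := {p : State × Tick | p.1.1 b = true})
            (show (s, x) ∉ {p : State × Tick | p.1.1 b = true} from hb) _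
        simp [h3])
    (fun R => ⌊β * (R * (δ / 2))⌋₊) (fun R => ⌊β * (R * δ)⌋₊) (fun R => floor_le_mul β δ R) hη
  have h3 := tendsto_prob_releases hγ lam hinit b (half_pos hq) (fun R => ⌊β * (R * δ)⌋₊)
    (fun R => floor_le_mul β δ R)
  have h123 := tendsto_of_tendsto_of_tendsto_of_le_of_le tendsto_const_nhds
    (by simpa only [add_zero] using (h1.add h2).add h3) (fun _ => zero_le)
    (fun R => (measure_union_le _ _).trans (add_le_add_left (measure_union_le _ _) _))
  refine (measure_eq_zero_iff_ae_notMem.1 (measure_eq_zero_of_isOpen hφ hμ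
    (G := {ω | Path.Q ω (δ / 2) a < η ∧ Path.Q ω δ z < η}) ?_ h123 ?_)).mono fun ω hω => ?_
  · exact (isOpen_lt (Path.continuous_Q_left _ a) continuous_const).inter
      (isOpen_lt (Path.continuous_Q_left _ z) continuous_const)
  · filter_upwards [eventually_gt_atTop 0, eventually_le_mul_natCast hη (1 + c),
      eventually_le_mul_natCast hη (1 + lam z / β),
      hx.eventually_const_le (show 3 / 4 * q < q by linarith)] with R hR hRa hRz hRq e ⟨hea, hez⟩
    have hR' : (0 : ℝ) < R := by exact_mod_cast hR
    have hval := fun u i => abs_le.1 (abs_scaled_queue_sub_le β hR γ (init R) e u i)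
    by_contra hnot
    simp only [Set.mem_union, not_or, Set.mem_ofPred_eq] at hnot
    obtain ⟨⟨hn1, hn2⟩, hn3⟩ := hnot
    have hm0 := mul_lt_floor_add_one β (δ / 2) R
    have hm1 := floor_le_mul β (δ / 2) R
    have hn0 := mul_lt_floor_add_one β δ R
    have hn1' := floor_le_mul β δ R
    have hva := hval (δ / 2) a
    have hvz := hval δ z
    have hmn : ⌊β * (R * (δ / 2))⌋₊ ≤ ⌊β * (R * δ)⌋₊ :=
      Nat.floor_mono (by gcongr; exact half_le_self zero_le)
    set m := ⌊β * (R * (δ / 2))⌋₊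
    set n := ⌊β * (R * δ)⌋₊
    push_cast at hm0 hm1
    set X := chain γ (init R) e with hX
    -- at most one packet leaves per step, so that the queue of `b` stays long
    have hlow : ∀ k ≤ n, q / 2 * R ≤ queue b (X k) := by
      have hstep : ∀ k, queue b (X 0) - k ≤ queue b (X k) := by
        intro k
        induction k with
        | zero => simp
        | succ k ih =>
          have := (abs_le.1 (abs_queue_chain_succ_sub_le γ (init R) e b k)).1
          push_cast
          linarith
      intro k hk
      have h4 : 3 / 4 * q * R ≤ queue b (X 0) := by
        rwa [le_div_iff₀ hR'] at hRq
      have h5 : (k : ℝ) ≤ n := by exact_mod_cast hk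
      have h6 := mul_le_mul_of_nonneg_right hδq hR'.le
      linarith [hstep k]
    have hRη := mul_lt_mul_of_pos_left hea hR'
    have hRη' := mul_lt_mul_of_pos_left hez hR'
    by_cases hact : ∃ k ≤ m, (X k).1 b = true
    · obtain ⟨k, hkm, hk⟩ := hact
      have hstay : ∀ j, k ≤ j → j ≤ n → (X j).1 b = true := by
        intro j hkj
        induction j, hkj using Nat.le_induction with
        | base => exact fun _ => hk
        | succ j hkj ih =>
          intro hj
          have h4 := ih (by omega)
          by_contra h5
          exact hn3 ⟨j, by omega, hlow j (by omega), h4, by simpa [hX, chain] using h5⟩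
      have hsum : ∑ j ∈ Finset.Ico m n, {p : State × Tick | p.1.1 b = true}.indicator (fun p =>
            incr γ (queue z) p - lam z / β) (X j, e j) =
          queue z (X n) - queue z (X m) - (n - m) * (lam z / β) := by
        rw [← sum_incr γ (queue z) (init R) e hmn, Finset.sum_congr rfl fun j hj =>
          Set.indicator_of_mem (s := {p : State × Tick | p.1.1 b = true})
            (show (X j, e j) ∈ {p : State × Tick | p.1.1 b = true} from
              hstay j (hkm.trans (Finset.mem_Ico.1 hj).1) (Finset.mem_Ico.1 hj).2.le) _,
          Finset.sum_sub_distrib, Finset.sum_const, Nat.card_Ico, nsmul_eq_mul, Nat.cast_sub hmn]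
      rw [hsum] at hn2
      have h4 : 0 ≤ queue z (X m) := Nat.cast_nonneg _
      have h5 : (β * (δ / 2) * R - 1) * (lam z / β : ℝ) ≤ (n - m) * (lam z / β) :=
        mul_le_mul_of_nonneg_right (by linarith) hz0
      have h6 : (β * (δ / 2) * R - 1) * (lam z / β : ℝ) = lam z * δ * R / 2 - lam z / β := by
        field_simp
      have h7 := mul_le_mul_of_nonneg_right hηz hR'.le
      linarith [hvz.1]
    · push Not at hact
      have hgrow : ∀ k ≤ m, queue b (X 0) ≤ queue b (X k) := by
        intro k
        induction k with
        | zero => exact fun _ => le_rfl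
        | succ k ih =>
          intro hk
          have h4 : act b (X k) = 0 := by simp [act, hact k (by omega)]
          have h5 := incr_queue_eq γ b ((hinit R).chain (γ := γ) e k) (e k)
          have h6 : 0 ≤ tickOf (Sum.inl b) (e k) := by unfold tickOf; split_ifs <;> norm_num
          change queue b (X (k + 1)) - queue b (X k) = _ - act b (X k) * _ at h5
          rw [h4] at h5
          linarith [ih (by omega)]
      rw [sum_growthIncr (Nat.zero_le _)
        fun k hk => hlow k (((Finset.mem_Ico.1 hk).2.le).trans hmn)] at hn1
      have h4 : act b (X m) = 0 := by simp [act, hact m le_rfl]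
      have h5 : 0 ≤ queue a (X 0) := Nat.cast_nonneg _
      have h6 := act_nonneg b (X 0)
      have h7 : (β * (δ / 2) * R - 1) * c ≤ m * c :=
        mul_le_mul_of_nonneg_right (by linarith) hc0
      have h8 : (β * (δ / 2) * R - 1) * c = 3 / 8 * ((lam a - lam b) * δ * R) - c := by
        rw [hc]; field_simp; ring
      have h9 := mul_le_mul_of_nonneg_right hηa hR'.le
      simp only [← hX, h4, Nat.cast_zero, sub_zero, ← hβdef, ← hc] at hn1
      linarith [hva.1, hgrow m le_rfl]
  · by_contra! h
    exact hω ⟨h.1, h.2⟩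

end FluidLimit

/-! ### Natural states and nonemptiness -/

/-- The time by which the state of every fluid limit with an initial state of norm one is natural.
Both differences are positive under the conditions on the arrival rates. -/
noncomputable def settlingTime (lam : Fin 6 → ℝ≥0) : ℝ≥0 :=
  4 / min (lam 2 - lam 3) (lam 5 - lam 4)

lemma adj_two_of_adj_three (j : Fin 6) (h : graph.Adj 3 j) : graph.Adj 2 j := by
  fin_cases j <;> simp_all [graph, component]

lemma adj_five_of_adj_four (j : Fin 6) (h : graph.Adj 4 j) : graph.Adj 5 j := by
  fin_cases j <;> simp_all [graph, component]

/-- A function `f` that catches up with `g` at a positive rate while `g` is positive exceeds `g`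
from some time on, except at common zeros: it does so since the last zero of `g`, or since the
beginning. -/
lemma le_of_growth {f g : ℝ≥0 → ℝ} (hg : Continuous g) (hf0 : ∀ t, 0 ≤ f t)
    (hg0 : ∀ t, 0 ≤ g t) {c : ℝ} (hc : 0 < c)
    (h : ∀ s t : ℝ≥0, s < t → (∀ u ∈ Set.Ioo s t, 0 < g u) →
      c * (t - s) ≤ (f t - g t) - (f s - g s))
    (hinit : -1 ≤ f 0 - g 0) {t : ℝ≥0} (ht : 1 < c * t) :
    g t ≤ f t ∧ (f t = g t → f t = 0 ∧ g t = 0) := by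
  rcases (hg0 t).eq_or_lt with h0 | hpos
  · exact ⟨h0 ▸ hf0 t, fun he => ⟨he.trans h0.symm, h0.symm⟩⟩
  suffices g t < f t from ⟨this.le, fun he => absurd he this.ne'⟩
  by_cases hz : ∃ u ≤ t, g u = 0
  · obtain ⟨u, hut, hu⟩ := hz
    have hcomp : IsCompact (Set.Icc 0 t ∩ {u | g u = 0}) :=
      isCompact_Icc.inter_right (isClosed_eq hg continuous_const)
    obtain ⟨s, ⟨hs, hs0⟩, hmax⟩ := hcomp.exists_isGreatest ⟨u, ⟨zero_le, hut⟩, hu⟩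
    have hs0' : g s = 0 := hs0
    have hst : s < t := hs.2.lt_of_ne fun he => by rw [he] at hs0'; exact hpos.ne' hs0'
    have h1 := h s t hst fun v hv => (hg0 v).lt_of_ne fun he =>
      hv.1.not_ge (hmax ⟨⟨zero_le, hv.2.le⟩, he.symm⟩)
    have h2 : (s : ℝ) < t := hst
    have h3 : 0 < c * (t - s) := mul_pos hc (by linarith)
    linarith [hf0 s]
  · push Not at hz
    have ht0 : 0 < t := by
      rcases eq_or_ne t 0 with rfl | h0
      · simp at ht; linarith
      · exact pos_iff_ne_zero.2 h0
    have h1 := h 0 t ht0 fun v hv => (hg0 v).lt_of_ne (hz v hv.2.le).symm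
    simp only [NNReal.coe_zero, sub_zero] at h1
    linarith

lemma tendsto_initial_apply {init : ℕ → State} {q : EuclideanSpace ℝ (Fin 6)}
    (h : Tendsto (fun R : ℕ => WithLp.toLp 2 fun i => ((init R).2 i : ℝ) / R) atTop (𝓝 q))
    (i : Fin 6) : Tendsto (fun R : ℕ => ((init R).2 i : ℝ) / R) atTop (𝓝 (q i)) :=
  ((EuclideanSpace.proj (𝕜 := ℝ) i).continuous.tendsto q).comp h

lemma IsFluidLimit.apply_nonneg {γ : ℝ} {lam : Fin 6 → ℝ≥0} {q : EuclideanSpace ℝ (Fin 6)}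
    {μ : ProbabilityMeasure Path} (h : IsFluidLimit γ lam q μ) (i : Fin 6) : 0 ≤ q i := by
  obtain ⟨init, -, hq, -⟩ := h
  exact ge_of_tendsto' (tendsto_initial_apply hq i) fun R => by positivity

lemma one_lt_mul_settlingTime {d m : ℝ≥0} (hm : 0 < m) (hmd : m ≤ d) {t : ℝ≥0}
    (ht : 4 / m ≤ t) : 1 < (d : ℝ) / 2 * t := by
  rw [div_le_iff₀ hm] at ht
  have h1 : (4 : ℝ) ≤ t * m := by exact_mod_cast ht
  have h2 : (t : ℝ) * m ≤ t * d := by gcongr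
  linarith

/-- The state of a fluid limit is natural from the settling time on. -/
lemma IsFluidLimit.ae_isNatural {γ : ℝ} (hγ : 0 < γ) {lam : Fin 6 → ℝ≥0}
    (hlam : RateCondition lam) {q : EuclideanSpace ℝ (Fin 6)} (hq : ‖q‖ = 1)
    {μ : ProbabilityMeasure Path} (h : IsFluidLimit γ lam q μ) :
    ∀ᵐ ω ∂(μ : Measure Path), ∀ t : ℝ≥0, settlingTime lam ≤ t → IsNatural (Path.Q ω t) := by
  have hq0 := h.apply_nonneg
  have hq1 : ∀ i, q i ≤ 1 := fun i => (le_abs_self _).trans (hq ▸ PiLp.norm_apply_le q i)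
  obtain ⟨init, hinit, hlim, φ, hφ, hμ⟩ := h
  obtain ⟨-, -, -, h32, h45⟩ := hlam
  have hm : 0 < min (lam 2 - lam 3) (lam 5 - lam 4) :=
    lt_min (tsub_pos_of_lt h32) (tsub_pos_of_lt h45)
  have hstart : ∀ i, ∀ᵐ ω ∂(μ : Measure Path), Path.Q ω 0 i = q i := fun i =>
    ae_initial hφ hμ (tendsto_initial_apply hlim i)
  filter_upwards [ae_growth hγ hinit hφ hμ adj_two_of_adj_three h32,
    ae_growth hγ hinit hφ hμ adj_five_of_adj_four h45, ae_nonneg hφ hμ, ae_all_iff.2 hstart]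
    with ω hA hB hnn h0 t ht
  have hc := fun i => Path.continuous_Q_right ω i
  have key : ∀ a b : Fin 6, lam b < lam a →
      min (lam 2 - lam 3) (lam 5 - lam 4) ≤ lam a - lam b →
      (∀ s t : ℝ≥0, s < t → (∀ u ∈ Set.Ioo s t, 0 < Path.Q ω u b) →
        (lam a - lam b : ℝ) / 2 * (t - s) ≤
          (Path.Q ω t a - Path.Q ω t b) - (Path.Q ω s a - Path.Q ω s b)) →
      Path.Q ω t b ≤ Path.Q ω t a ∧
        (Path.Q ω t a = Path.Q ω t b → Path.Q ω t a = 0 ∧ Path.Q ω t b = 0) := by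
    intro a b hba hmin hgrow
    have hba' : (lam b : ℝ) < lam a := hba
    refine le_of_growth (hc b) (fun t => hnn t a) (fun t => hnn t b)
      (by linarith : 0 < (lam a - lam b : ℝ) / 2) hgrow ?_ ?_
    · rw [h0 a, h0 b]
      linarith [hq0 a, hq1 b]
    · have := one_lt_mul_settlingTime hm hmin ht
      rwa [NNReal.coe_sub hba.le] at this
  exact ⟨key 2 3 h32 (min_le_left _ _) hA, key 5 4 h45 (min_le_right _ _) hB⟩

lemma settlingTime_smul (ρ : ℝ≥0) (κ : Fin 6 → ℝ≥0) :
    settlingTime (ρ • κ) = 4 / (ρ * min (κ 2 - κ 3) (κ 5 - κ 4)) := by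
  simp only [settlingTime, Pi.smul_apply, smul_eq_mul, ← mul_tsub, mul_min]

/-- Close to critical load, the clique workload that can be lost until the settling time is
arbitrarily small. -/
lemma exists_critical {κ : Fin 6 → ℝ≥0} (hκ : RateCondition κ) {η : ℝ} (hη : 0 < η) :
    ∃ ρstar : ℝ≥0, ρstar < 1 ∧ ∀ ρ : ℝ≥0, ρstar ≤ ρ → ρ < 1 →
      1 / 2 ≤ ρ ∧ (1 - ρ : ℝ) * settlingTime (ρ • κ) < η := by
  obtain ⟨-, -, -, h32, h45⟩ := hκ
  have hm : 0 < min (κ 2 - κ 3) (κ 5 - κ 4) := lt_min (tsub_pos_of_lt h32) (tsub_pos_of_lt h45)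
  simp only [settlingTime_smul]
  generalize min (κ 2 - κ 3) (κ 5 - κ 4) = m at *
  have hm' : (0 : ℝ) < m := hm
  have hε : 0 < min (1 / 2) (η * m / 16) := by positivity
  refine ⟨Real.toNNReal (1 - min (1 / 2) (η * m / 16)), ?_, fun ρ h1 h2 => ?_⟩
  · rw [Real.toNNReal_lt_one]; linarith
  rw [Real.toNNReal_le_iff_le_coe] at h1
  have h3 := min_le_left (1 / 2 : ℝ) (η * m / 16)
  have h4 := min_le_right (1 / 2 : ℝ) (η * m / 16)
  have h5 : (1 : ℝ) / 2 ≤ ρ := by linarith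
  refine ⟨by exact_mod_cast h5, ?_⟩
  push_cast
  rw [mul_div_assoc', div_lt_iff₀ (by positivity)]
  have h6 : η * m * (1 / 2) ≤ η * m * ρ := by gcongr
  have h7 : 0 < η * m := by positivity
  linarith

/-- If one of the cliques `{x, 3, 6}`, with `x = 1` or `x = 2`, has a large enough workload at some
time, then the network is nonempty at the settling time. -/
lemma exists_pos_of_workload {ω : Path} {x : Fin 6} {s T : ℝ≥0} {ℓ η : ℝ} (hℓ : ℓ < 1)
    (hη : (1 - ℓ) * T < η) (hs : η ≤ Path.Q ω s x + Path.Q ω s 2 + Path.Q ω s 5)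
    (h : Path.Q ω s x + Path.Q ω s 2 + Path.Q ω s 5 - (1 - ℓ) * (T - s) ≤
      Path.Q ω T x + Path.Q ω T 2 + Path.Q ω T 5) :
    ∃ i, 0 < Path.Q ω T i := by
  by_contra! hneg
  have h1 : 0 ≤ (1 - ℓ) * s := mul_nonneg (by linarith) s.2
  linarith [hneg x, hneg 2, hneg 5]

lemma adj_clique {x : Fin 6} (hx : x = 0 ∨ x = 1) :
    graph.Adj x 2 ∧ graph.Adj 2 5 ∧ graph.Adj x 5 := by
  rcases hx with rfl | rfl <;> simp [graph, component]

lemma load_clique {κ : Fin 6 → ℝ≥0} (hκ : RateCondition κ) (hload : load κ = 1) (ρ : ℝ≥0)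
    {x : Fin 6} (hx : x = 0 ∨ x = 1) :
    ((ρ • κ) x + (ρ • κ) 2 + (ρ • κ) 5 : ℝ) = ρ := by
  have h1 : κ x + κ 2 + κ 5 = 1 := by
    rw [← hload, load, ← hκ.2.1, max_self]
    rcases hx with rfl | rfl
    · rfl
    · rw [hκ.2.1]
  have h2 : (κ x + κ 2 + κ 5 : ℝ) = 1 := by exact_mod_cast h1
  simp only [Pi.smul_apply, smul_eq_mul, NNReal.coe_mul]
  rw [← mul_add, ← mul_add, h2, mul_one]

/-- Nonemptiness if a clique has work initially. -/
lemma exists_critical_of_clique {γ : ℝ} {κ : Fin 6 → ℝ≥0} (hκ : RateCondition κ)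
    (hload : load κ = 1) {q : EuclideanSpace ℝ (Fin 6)} {x : Fin 6} (hx : x = 0 ∨ x = 1)
    (hq : 0 < q x + q 2 + q 5) :
    ∃ ρstar : ℝ≥0, ρstar < 1 ∧ ∀ ρ : ℝ≥0, ρstar ≤ ρ → ρ < 1 →
      ∀ μ : ProbabilityMeasure Path, IsFluidLimit γ (ρ • κ) q μ →
        ∀ᵐ ω ∂(μ : Measure Path), ∃ i, 0 < Path.Q ω (settlingTime (ρ • κ)) i := by
  obtain ⟨ρstar, h1, h2⟩ := exists_critical hκ hq
  refine ⟨ρstar, h1, fun ρ hρ hρ1 μ hμ => ?_⟩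
  obtain ⟨init, hinit, hlim, φ, hφ, hμ⟩ := hμ
  obtain ⟨hx2, h25, hx5⟩ := adj_clique hx
  filter_upwards [ae_workload hinit hφ hμ hx2 h25 hx5 (zero_le (a := settlingTime (ρ • κ))),
    ae_initial hφ hμ (tendsto_initial_apply hlim x),
    ae_initial hφ hμ (tendsto_initial_apply hlim 2),
    ae_initial hφ hμ (tendsto_initial_apply hlim 5)] with ω hω hx0 h20 h50
  rw [load_clique hκ hload ρ hx] at hω
  exact exists_pos_of_workload (by exact_mod_cast hρ1) (h2 ρ hρ hρ1).2
    (by rw [hx0, h20, h50]) hω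

/-- Nonemptiness if node `b` has work initially, where `(a, b)` is `(3, 4)` or `(6, 5)`. -/
lemma exists_critical_of_feed {γ : ℝ} (hγ : 1 < γ) {κ : Fin 6 → ℝ≥0} (hκ : RateCondition κ)
    (hload : load κ = 1) {q : EuclideanSpace ℝ (Fin 6)} (hq1 : ‖q‖ = 1) {a b : Fin 6}
    (ha : a = 2 ∨ a = 5) (hnbr : ∀ j, graph.Adj b j → graph.Adj a j) (hb0 : graph.Adj b 0)
    (hba : κ b < κ a) (hq : 0 < q b) :
    ∃ ρstar : ℝ≥0, ρstar < 1 ∧ ∀ ρ : ℝ≥0, ρstar ≤ ρ → ρ < 1 →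
      ∀ μ : ProbabilityMeasure Path, IsFluidLimit γ (ρ • κ) q μ →
        ∀ᵐ ω ∂(μ : Measure Path), ∃ i, 0 < Path.Q ω (settlingTime (ρ • κ)) i := by
  have hβ : (0 : ℝ) < clockRate κ := clockRate_pos κ
  have hβ6 : (6 : ℝ) ≤ clockRate κ := by
    have : 6 ≤ clockRate κ := le_add_self
    exact_mod_cast this
  have hba' : (κ b : ℝ) < κ a := hba
  have hκ0 : (0 : ℝ) < κ 0 := hκ.1 0
  have hqb : q b ≤ 1 := (le_abs_self _).trans (hq1 ▸ PiLp.norm_apply_le q b)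
  -- the time at most `1`, hence before the settling time, and small enough for `ae_feed`
  obtain ⟨δ, hδ⟩ : ∃ δ : ℝ≥0, (δ : ℝ) = q b / (4 * clockRate κ) :=
    ⟨⟨_, by positivity⟩, rfl⟩
  have hδ0 : 0 < (δ : ℝ) := by rw [hδ]; positivity
  have hδ1 : δ ≤ 1 := by
    have : (δ : ℝ) ≤ 1 := by
      rw [hδ, div_le_one (by positivity)]
      linarith
    exact_mod_cast this
  -- `ae_feed` needs `8 η ≤ ρ d δ`, and `ρ ≥ 1 / 2`
  set d := min (κ a - κ b : ℝ) (κ 0) with hd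
  have hd0 : 0 < d := lt_min (by linarith) hκ0
  have hη : 0 < d * δ / 16 := by positivity
  obtain ⟨ρstar, h1, h2⟩ := exists_critical hκ hη
  refine ⟨ρstar, h1, fun ρ hρ hρ1 μ hμ => ?_⟩
  obtain ⟨hρ2, h3⟩ := h2 ρ hρ hρ1
  obtain ⟨init, hinit, hlim, φ, hφ, hμ⟩ := hμ
  obtain ⟨h02, h25, h05⟩ := adj_clique (x := 0) (Or.inl rfl)
  have hρ0 : 0 < ρ := lt_of_lt_of_le (by norm_num) hρ2
  have hρ2' : (1 / 2 : ℝ) ≤ ρ := by exact_mod_cast hρ2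
  have hρ1' : (ρ : ℝ) < 1 := by exact_mod_cast hρ1
  have hδT : δ ≤ settlingTime (ρ • κ) := by
    have hm : 0 < min (κ 2 - κ 3) (κ 5 - κ 4) :=
      lt_min (tsub_pos_of_lt hκ.2.2.2.1) (tsub_pos_of_lt hκ.2.2.2.2)
    have h4 : min (κ 2 - κ 3) (κ 5 - κ 4) ≤ 1 := by
      refine (min_le_left _ _).trans (tsub_le_self.trans ?_)
      rw [← hload, load, add_right_comm]
      exact le_add_self
    rw [settlingTime_smul, le_div_iff₀ (by positivity)]
    calc δ * (ρ * min (κ 2 - κ 3) (κ 5 - κ 4)) ≤ 1 * (1 * 1) := by gcongr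
      _ ≤ 4 := by norm_num
  have hclock : (clockRate (ρ • κ) : ℝ) ≤ clockRate κ := by
    have : clockRate (ρ • κ) ≤ clockRate κ := by
      simp only [clockRate, Pi.smul_apply, smul_eq_mul]
      gcongr
      exact mul_le_of_le_one_left zero_le hρ1.le
    exact_mod_cast this
  have hfeed := ae_feed hγ hinit hφ hμ hnbr hb0
    (by simpa only [Pi.smul_apply, smul_eq_mul] using mul_lt_mul_of_pos_left hba hρ0) hq
    (tendsto_initial_apply hlim b)
    (by
      have h4 : 4 * (clockRate κ : ℝ) * δ = q b := by rw [hδ]; field_simp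
      rw [← h4]
      gcongr) hη
    (by
      simp only [Pi.smul_apply, smul_eq_mul, NNReal.coe_mul]
      have h4 : d ≤ κ a - κ b := min_le_left _ _
      have h5 : 1 / 2 * d ≤ ρ * (κ a - κ b) := by gcongr
      have h6 := mul_le_mul_of_nonneg_right h5 hδ0.le
      linarith)
    (by
      simp only [Pi.smul_apply, smul_eq_mul, NNReal.coe_mul]
      have h4 : d ≤ κ 0 := min_le_right _ _
      have h5 : 1 / 2 * d ≤ ρ * κ 0 := by gcongr
      have h6 := mul_le_mul_of_nonneg_right h5 hδ0.le
      linarith)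
  filter_upwards [hfeed, ae_nonneg hφ hμ,
    ae_workload hinit hφ hμ h02 h25 h05 ((half_le_self zero_le).trans hδT),
    ae_workload hinit hφ hμ h02 h25 h05 hδT] with ω hω hnn hw1 hw2
  rw [load_clique hκ hload ρ (Or.inl rfl)] at hw1 hw2
  rcases hω with hω | hω
  · refine exists_pos_of_workload hρ1' h3 ?_ hw1
    rcases ha with rfl | rfl <;> linarith [hnn (δ / 2) 0, hnn (δ / 2) 2, hnn (δ / 2) 5]
  · exact exists_pos_of_workload hρ1' h3 (by linarith [hnn δ 2, hnn δ 5]) hw2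

end BrokenDiamond

theorem mainTheorem7 (γ : ℝ) (hγ : 1 < γ) :
    ∃ T : (Fin 6 → ℝ≥0) → ℝ≥0,
      (∀ lam : Fin 6 → ℝ≥0, BrokenDiamond.RateCondition lam →
        0 < T lam ∧
        ∀ (q : EuclideanSpace ℝ (Fin 6)) (μ : ProbabilityMeasure BrokenDiamond.Path),
          ‖q‖ = 1 → BrokenDiamond.IsFluidLimit γ lam q μ →
          ∀ᵐ ω ∂(μ : Measure BrokenDiamond.Path), ∀ t : ℝ≥0, T lam ≤ t →
            BrokenDiamond.IsNatural (BrokenDiamond.Path.Q ω t)) ∧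
      (∀ κ : Fin 6 → ℝ≥0, BrokenDiamond.RateCondition κ → BrokenDiamond.load κ = 1 →
        ∀ q : EuclideanSpace ℝ (Fin 6), ‖q‖ = 1 →
        ∃ ρstar : ℝ≥0, ρstar < 1 ∧ ∀ ρ : ℝ≥0, ρstar ≤ ρ → ρ < 1 →
          ∀ μ : ProbabilityMeasure BrokenDiamond.Path,
            BrokenDiamond.IsFluidLimit γ (ρ • κ) q μ →
            ∀ᵐ ω ∂(μ : Measure BrokenDiamond.Path),
              ∃ i : Fin 6, 0 < BrokenDiamond.Path.Q ω (T (ρ • κ)) i) := by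
  refine ⟨BrokenDiamond.settlingTime, fun lam hlam => ⟨?_, fun q μ hq hμ =>
    hμ.ae_isNatural (zero_lt_one.trans hγ) hlam hq⟩, fun κ hκ hload q hq => ?_⟩
  · exact div_pos (by norm_num)
      (lt_min (tsub_pos_of_lt hlam.2.2.2.1) (tsub_pos_of_lt hlam.2.2.2.2))
  · by_cases hq0 : ∀ i, 0 ≤ q i
    · obtain ⟨i, hi⟩ : ∃ i, 0 < q i := by
        by_contra! hneg
        have : q = 0 := by ext i; exact le_antisymm (hneg i) (hq0 i)
        simp [this] at hq
      have hcases : (∃ x : Fin 6, (x = 0 ∨ x = 1) ∧ 0 < q x + q 2 + q 5) ∨ 0 < q 3 ∨ 0 < q 4 := by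
        have h0 := hq0 0
        have h1 := hq0 1
        have h2 := hq0 2
        have h5 := hq0 5
        fin_cases i <;> simp only [Fin.reduceFinMk, Fin.zero_eta, Fin.mk_one] at hi
        · exact Or.inl ⟨0, Or.inl rfl, by linarith⟩
        · exact Or.inl ⟨1, Or.inr rfl, by linarith⟩
        · exact Or.inl ⟨0, Or.inl rfl, by linarith⟩
        · exact Or.inr (Or.inl hi)
        · exact Or.inr (Or.inr hi)
        · exact Or.inl ⟨0, Or.inl rfl, by linarith⟩
      rcases hcases with ⟨x, hx, hxq⟩ | h3 | h4
      · exact BrokenDiamond.exists_critical_of_clique hκ hload hx hxq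
      · exact BrokenDiamond.exists_critical_of_feed hγ hκ hload hq (Or.inl rfl)
          BrokenDiamond.adj_two_of_adj_three
          (by simp [BrokenDiamond.graph, BrokenDiamond.component]) hκ.2.2.2.1 h3
      · exact BrokenDiamond.exists_critical_of_feed hγ hκ hload hq (Or.inr rfl)
          BrokenDiamond.adj_five_of_adj_four
          (by simp [BrokenDiamond.graph, BrokenDiamond.component]) hκ.2.2.2.2 h4
    · -- queue lengths are nonnegative, so that there is no fluid limit starting from `q`
      exact ⟨0, zero_lt_one, fun ρ _ _ μ hμ => absurd hμ.apply_nonneg hq0⟩
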